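/- **Setting.** Let $d_{\rm in},d_{\rm out},k,N_b,N_r$ be non-negative integers with $N_r\ge 1$. For a smooth $u:\mathbb R^{d_{\rm in}}\to\mathbb R^{d_{\rm out}}$ let $\Phi[u](x)=(\partial^\alpha u_c(x))_{|\alpha|\le k,\;1\le c\le d_{\rm out}}$ be the vector of all (mixed) partial derivatives of $u$ at $x$ of order at most $k$, each multi-index $\alpha\in\mathbb N^{d_{\rm in}}$ being listed once, and let $D$ be its length. Let $R:\mathbb R^{D}\to\mathbb R$ be continuously differentiable and nonlinear, i.e. not of the form $R(z)=\ell(z)+a$ with $\ell$ linear and $a\in\mathbb R$. Let $x^b_1,\dots,x^b_{N_b}$ and $x^r_1,\dots,x^r_{N_r}$ be points of $\mathbb R^{d_{\rm in}}$ (boundary and collocation points). Let $\sigma:\mathbb R\to\mathbb R$ be $C^\infty$, with $\sigma^{(i)}$ bounded for $1\le i\le k+1$ and $\sigma^{(k)}\not\equiv 0$. The network of width $m$ is $$u_\theta(x)=\tfrac1{\sqrt m}\,W^1\sigma(W^0x+b^0)+b^1,\qquad \theta=(W^0,b^0,W^1,b^1)\in\mathbb R^{m\times d_{\rm in}}\times\mathbb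 R^m\times\mathbb R^{d_{\rm out}\times m}\times\mathbb R^{d_{\rm out}},$$ with residual $r_\theta(x)=R(\Phi[u_\theta](x))$. Put $$J=\begin{bmatrix}\partial_\theta u_\theta(\mathbf x^b)\\ \partial_\theta r_\theta(\mathbf x^r)\end{bmatrix},\quad K=JJ^T,\qquad J_\Phi=\begin{bmatrix}\partial_\theta u_\theta(\mathbf x^b)\\ \partial_\theta \Phi[u_\theta](\mathbf x^r)\end{bmatrix},\quad K_\Phi=J_\Phi J_\Phi^T,$$ and for $z=(z_1,\dots,z_{N_r})\in(\mathbb R^D)^{N_r}$ let $\Lambda_R(z)=\mathrm{diag}\big(\mathrm{Id},\nabla R(z_1),\dots,\nabla R(z_{N_r})\big)$, the gradients being row vectors. For each $m$ let all entries of $\theta=\theta(0)$ be i.i.d. $\mathcal N(0,1)$; $K(0)$, $K_\Phi(0)$ denote the resulting random matrices. For $w\in\mathbb R^{d_{\rm in}}$, $b\in\mathbb R$ put $\psi_\alpha(x;w,b)=\partial_x^\alpha[\sigma(w\cdot x+b)]$, and let $\mathbb E$ be the expectation over $(w,b)\sim\mathcal N(0,\mathrm{Id})$. Define $$\Sigma_{(\alpha,c),(\beta,c')}(x,y)=\delta_{cc'}\big(\mathbb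 E[\psi_\alpha(x)\psi_\beta(y)]+\mathbf 1_{\alpha=\beta=0}\big),$$ $$\kappa_{(\alpha,c),(\beta,c')}(x,y)=\Sigma_{(\alpha,c),(\beta,c')}(x,y)+\delta_{cc'}\Big(\mathbb E[\partial_b\psi_\alpha(x)\,\partial_b\psi_\beta(y)]+\sum_{p=1}^{d_{\rm in}}\mathbb E[\partial_{w_p}\psi_\alpha(x)\,\partial_{w_p}\psi_\beta(y)]\Big).$$ Let $\bar K_\Phi$ be the deterministic matrix with entries $\kappa$, its rows and columns being indexed by the pairs $(x^b_i,(0,c))$ and $(x^r_i,(\alpha,c))$. Let $G=(G_1,\dots,G_{N_r})$ be a centred Gaussian vector in $(\mathbb R^D)^{N_r}$ with $\mathrm{Cov}(G_i,G_j)=\Sigma(x^r_i,x^r_j)$ (the centred Gaussian process with covariance $\Sigma$ at the collocation points). **Theorem.** 1. For every $m$ and every $\theta$, $K=\Lambda_R(\Phi[u_\theta](\mathbf x^r))\,K_\Phi\,\Lambda_R(\Phi[u_\theta](\mathbf x^r))^T$. 2. As $m\to\infty$, $K_\Phi(0)\to\bar K_\Phi$ in probability. 3. As $m\to\infty$, $\Phi[u_{\theta(0)}](\mathbf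 x^r)\to G$ and $\Lambda_R(\Phi[u_{\theta(0)}](\mathbf x^r))\to\Lambda_R(G)$ in distribution. 4. As $m\to\infty$, $K(0)\to\bar K:=\Lambda_R(G)\,\bar K_\Phi\,\Lambda_R(G)^T$ in distribution. 5. $\bar K$ is not deterministic: there is no fixed matrix $K_0$ with $\bar K=K_0$ almost surely. -/

import Mathlib

open MeasureTheory ProbabilityTheory Filter Topology Matrix
open scoped ContDiff

namespace PINN

noncomputable section

/-! ### Partial derivatives and the vector of all derivatives up to order `k` -/

/-- Multi-indices `α ∈ ℕ^d` of order `|α| ≤ k`. -/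
abbrev MultiIdx (d k : ℕ) : Type :=
  {α : Fin d → Fin (k + 1) // ∑ p, (α p : ℕ) ≤ k}

/-- The partial derivative `∂g/∂x_p`. -/
def partialDeriv {ι : Type} [Fintype ι] [DecidableEq ι] (p : ι) (g : (ι → ℝ) → ℝ) :
    (ι → ℝ) → ℝ :=
  fun x => fderiv ℝ g x (Pi.single p 1)

/-- The mixed partial derivative `∂^α g = ∂_1^{α_1} ⋯ ∂_d^{α_d} g`. -/
def mixedDeriv {d k : ℕ} (α : MultiIdx d k) (g : (Fin d → ℝ) → ℝ) : (Fin d → ℝ) → ℝ :=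
  (List.finRange d).foldr (fun p h => (partialDeriv p)^[(α.1 p : ℕ)] h) g

/-- Index set of the components of `Φ[u](x)`: a multi-index and an output coordinate. -/
abbrev Comp (din dout k : ℕ) : Type := MultiIdx din k × Fin dout

/-- `Φ[u](x)`, the vector of all partial derivatives of `u` at `x` of order at most `k`. -/
def Phi {din dout : ℕ} (k : ℕ) (u : (Fin din → ℝ) → Fin dout → ℝ) (x : Fin din → ℝ) :
    Comp din dout k → ℝ :=
  fun e => mixedDeriv e.1 (fun y => u y e.2) x

/-! ### The network -/

/-- Index set of the parameters `W⁰ ∈ ℝ^{m × din}`, `b⁰ ∈ ℝ^m`, `W¹ ∈ ℝ^{dout × m}`,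
`b¹ ∈ ℝ^dout`, in this order. -/
abbrev ParamIdx (din dout m : ℕ) : Type :=
  (Fin m × Fin din) ⊕ (Fin m) ⊕ (Fin dout × Fin m) ⊕ (Fin dout)

/-- Parameter vectors `θ = (W⁰, b⁰, W¹, b¹)`. -/
abbrev Param (din dout m : ℕ) : Type := ParamIdx din dout m → ℝ

section Accessors

variable {din dout m : ℕ} (θ : Param din dout m)

def W0 (l : Fin m) (p : Fin din) : ℝ := θ (Sum.inl (l, p))

def b0 (l : Fin m) : ℝ := θ (Sum.inr (Sum.inl l))

def W1 (c : Fin dout) (l : Fin m) : ℝ := θ (Sum.inr (Sum.inr (Sum.inl (c, l))))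

def b1 (c : Fin dout) : ℝ := θ (Sum.inr (Sum.inr (Sum.inr c)))

end Accessors

/-- The network `u_θ(x) = m^{-1/2} W¹ σ(W⁰ x + b⁰) + b¹`. -/
def network {din dout m : ℕ} (σ : ℝ → ℝ) (θ : Param din dout m) (x : Fin din → ℝ) :
    Fin dout → ℝ :=
  fun c => 1 / √(m : ℝ) * ∑ l, W1 θ c l * σ (∑ p, W0 θ l p * x p + b0 θ l) + b1 θ c

/-- The law of `θ(0)`: all parameters are i.i.d. standard Gaussian. -/
abbrev gaussianInit (din dout m : ℕ) : Measure (Param din dout m) :=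
  Measure.pi fun _ => gaussianReal 0 1

/-! ### The tangent kernel and its factors -/

/-- Row index of `K`: boundary outputs `u_θ(x^b_i)_c` and residuals `r_θ(x^r_i)`. -/
abbrev Row (dout Nb Nr : ℕ) : Type := (Fin Nb × Fin dout) ⊕ Fin Nr

/-- Row index of `K_Φ`: boundary outputs `u_θ(x^b_i)_c` and components of `Φ[u_θ](x^r_i)`. -/
abbrev LinRow (din dout k Nb Nr : ℕ) : Type :=
  (Fin Nb × Fin dout) ⊕ (Fin Nr × Comp din dout k)

/-- The matrix `∂_θ F(θ)` of partial derivatives of a vector-valued function of `θ`. -/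
def paramJacobian {ι : Type} {din dout m : ℕ} (F : Param din dout m → ι → ℝ)
    (θ : Param din dout m) : Matrix ι (ParamIdx din dout m) ℝ :=
  Matrix.of fun i p => partialDeriv p (fun θ' => F θ' i) θ

section Kernel

variable {din dout k Nb Nr : ℕ} (σ : ℝ → ℝ) (R : (Comp din dout k → ℝ) → ℝ)
  (xb : Fin Nb → Fin din → ℝ) (xr : Fin Nr → Fin din → ℝ)

/-- The vector of all `u_θ(x^b_i)` and all residuals `r_θ(x^r_i) = R(Φ[u_θ](x^r_i))`. -/
def outputs {m : ℕ} (θ : Param din dout m) : Row dout Nb Nr → ℝ :=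
  Sum.elim (fun i => network σ θ (xb i.1) i.2) (fun i => R (Phi k (network σ θ) (xr i)))

/-- The vector of all `u_θ(x^b_i)` and all `Φ[u_θ](x^r_i)`. -/
def linOutputs {m : ℕ} (θ : Param din dout m) : LinRow din dout k Nb Nr → ℝ :=
  Sum.elim (fun i => network σ θ (xb i.1) i.2) (fun i => Phi k (network σ θ) (xr i.1) i.2)

/-- The neural tangent kernel `K = J Jᵀ` at the parameter `θ`. -/
def ntk {m : ℕ} (θ : Param din dout m) : Matrix (Row dout Nb Nr) (Row dout Nb Nr) ℝ :=
  paramJacobian (outputs σ R xb xr) θ * (paramJacobian (outputs σ R xb xr) θ)ᵀ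

/-- The kernel `K_Φ` of the linear part. -/
def linNtk {m : ℕ} (θ : Param din dout m) :
    Matrix (LinRow din dout k Nb Nr) (LinRow din dout k Nb Nr) ℝ :=
  paramJacobian (linOutputs σ xb xr) θ * (paramJacobian (linOutputs σ xb xr) θ)ᵀ

/-- The matrix `Λ_R = diag(Id, ∇R(z_1), …, ∇R(z_{Nr}))`, where `z_i = z (i, ·)` stands for the
value of `Φ[u](x^r_i)`; each `∇R(z_i)` is a row vector. -/
def lambdaR (Nb : ℕ) (z : Fin Nr × Comp din dout k → ℝ) :
    Matrix (Row dout Nb Nr) (LinRow din dout k Nb Nr) ℝ :=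
  Matrix.fromBlocks 1 0 0
    (Matrix.of fun i je => if i = je.1 then partialDeriv je.2 R (fun e => z (i, e)) else 0)

/-- The stacked vector `Φ[u_θ](x^r)`. -/
def phiVec (k : ℕ) {m : ℕ} (θ : Param din dout m) : Fin Nr × Comp din dout k → ℝ :=
  fun ie => Phi k (network σ θ) (xr ie.1) ie.2

end Kernel

/-! ### The limiting objects -/

/-- Law of the weights `(w, b)` of one hidden neuron: standard Gaussian on `ℝ^d × ℝ`. -/
abbrev neuronLaw (d : ℕ) : Measure ((Fin d → ℝ) × ℝ) :=
  (Measure.pi fun _ => gaussianReal 0 1).prod (gaussianReal 0 1)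

/-- `∂^α_x [σ(w · x + b)]` at the point `x`, as a function of `w` and `b`. -/
def feature {d k : ℕ} (σ : ℝ → ℝ) (x : Fin d → ℝ) (α : MultiIdx d k) (w : Fin d → ℝ) (b : ℝ) : ℝ :=
  mixedDeriv α (fun y => σ (∑ p, w p * y p + b)) x

/-- The limiting covariance of `∂^α u_c(x)` and `∂^β u_{c'}(y)`. Distinct output coordinates are
uncorrelated, and the last term is the contribution of the outer bias `b¹`. -/
def phiCov {d k dout : ℕ} (σ : ℝ → ℝ) (x y : Fin d → ℝ) (e f : Comp d dout k) : ℝ :=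
  if e.2 = f.2 then
    (∫ v, feature σ x e.1 v.1 v.2 * feature σ y f.1 v.1 v.2 ∂neuronLaw d)
      + (if (∀ p, e.1.1 p = 0) ∧ (∀ p, f.1.1 p = 0) then 1 else 0)
  else 0

/-- The limiting tangent kernel of `∂^α u_c(x)` and `∂^β u_{c'}(y)`: the parameters `W¹, b¹`
contribute `phiCov`, and `b⁰`, `W⁰` contribute the two other terms. -/
def phiKernel {d k dout : ℕ} (σ : ℝ → ℝ) (x y : Fin d → ℝ) (e f : Comp d dout k) : ℝ :=
  phiCov σ x y e f +
    if e.2 = f.2 then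
      (∫ v, deriv (fun b => feature σ x e.1 v.1 b) v.2 *
          deriv (fun b => feature σ y f.1 v.1 b) v.2 ∂neuronLaw d)
        + ∑ p, ∫ v, partialDeriv p (fun w => feature σ x e.1 w v.2) v.1 *
            partialDeriv p (fun w => feature σ y f.1 w v.2) v.1 ∂neuronLaw d
    else 0

section Limit

variable {din dout k Nb Nr : ℕ} (σ : ℝ → ℝ) (R : (Comp din dout k → ℝ) → ℝ)
  (xb : Fin Nb → Fin din → ℝ) (xr : Fin Nr → Fin din → ℝ)

/-- The point at which a row of `K_Φ` is evaluated. -/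
def LinRow.point : LinRow din dout k Nb Nr → Fin din → ℝ :=
  Sum.elim (fun i => xb i.1) (fun i => xr i.1)

/-- The component of `Φ` to which a row of `K_Φ` belongs (a boundary row has `α = 0`). -/
def LinRow.comp : LinRow din dout k Nb Nr → Comp din dout k :=
  Sum.elim (fun i => (⟨fun _ => 0, by simp⟩, i.2)) (fun i => i.2)

/-- The deterministic limit of `K_Φ`. -/
def limitLinNtk : Matrix (LinRow din dout k Nb Nr) (LinRow din dout k Nb Nr) ℝ :=
  Matrix.of fun p q =>
    phiKernel σ (LinRow.point xb xr p) (LinRow.point xb xr q) (LinRow.comp p) (LinRow.comp q)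

/-- The law of the limiting Gaussian process of `Φ[u_θ]` at the points `x^r_i`: centred Gaussian
with covariance `phiCov`. -/
abbrev limitPhiLaw (dout k : ℕ) : Measure (EuclideanSpace ℝ (Fin Nr × Comp din dout k)) :=
  multivariateGaussian 0
    (Matrix.of fun ie jf => phiCov σ (xr ie.1) (xr jf.1) ie.2 jf.2)

/-- The limiting kernel `K̄ = Λ_R(G) K̄_Φ Λ_R(G)ᵀ` as a function of the value `G` of the
limiting Gaussian process at the points `x^r_i`. -/
def limitNtk (G : Fin Nr × Comp din dout k → ℝ) : Matrix (Row dout Nb Nr) (Row dout Nb Nr) ℝ :=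
  lambdaR R Nb G * limitLinNtk (dout := dout) (k := k) σ xb xr * (lambdaR R Nb G)ᵀ

end Limit

end

end PINN

namespace PINN

noncomputable section

/-! ### Derivatives of ridge functions -/

section Ridge

variable {d : ℕ} {ι : Type*} [Fintype ι]

/-! Differentiation of a ridge function gives `∂^α σ(w·x+b) = w^α σ^{(|α|)}(w·x+b)`. Hence every row
of the linearised outputs is `m^{-1/2} ∑_l W¹_{cl} F(w_l, b_l)`, plus an outer bias when `α = 0`.
The chain rule for `R ∘ Φ` yields the factorisation of `K`, and `linNtk_apply` exhibits each entry
of `K_Φ` as an empirical mean over i.i.d. neurons plus a constant.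

Features and their gradients grow polynomially, so all their Gaussian moments are finite.
Chebyshev's inequality then gives the limit of `K_Φ`, and characteristic functions
(`charFun_map_phiVec`) give the Gaussian limit of `Φ`. The limit of `K_Φ` being constant, Slutsky's
theorem and continuity of `∇R` give the limit of `K`.

For the last claim, a diagonal residual entry of `K̄` is `q(∇R(G_i))`, where `q` is the quadratic
form of `κ(x_i, x_i)`. Features at one point are linearly independent, so `Σ(x_i, x_i)` is positive
definite and `G_i` charges every open set. If the entry is almost surely constant, continuity makes
`q(∇R(z))` constant in `z`. As `κ - Σ` is positive semidefinite, `q` is positive definite, and a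
linear change of variables turns the identity into `‖∇f‖ = c` on the whole space. A global solution
of this eikonal equation is affine (`affine_of_norm_fderiv_eq`), which contradicts the nonlinearity
of `R`. -/

lemma partialDeriv_ridge_sum (a b : ι → ℝ) (w : ι → Fin d → ℝ) (c : ℝ) {h : ℝ → ℝ}
    (hh : Differentiable ℝ h) (p : Fin d) :
    partialDeriv p (fun y => ∑ l, a l * h (∑ q, w l q * y q + b l) + c) =
      fun y => ∑ l, a l * w l p * deriv h (∑ q, w l q * y q + b l) := by
  funext y
  have h1 : ∀ l, HasFDerivAt (fun y : Fin d → ℝ => ∑ q, w l q * y q + b l)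
      (∑ q, w l q • ContinuousLinearMap.proj (R := ℝ) (φ := fun _ : Fin d => ℝ) q) y := by
    intro l
    refine HasFDerivAt.add_const _ (HasFDerivAt.fun_sum fun q _ => ?_)
    exact (hasFDerivAt_apply q y).const_mul (w l q)
  have h2 : HasFDerivAt (fun y : Fin d → ℝ => ∑ l, a l * h (∑ q, w l q * y q + b l) + c)
      (∑ l, a l • deriv h (∑ q, w l q * y q + b l) •
        (∑ q, w l q • ContinuousLinearMap.proj (R := ℝ) (φ := fun _ : Fin d => ℝ) q)) y := by
    refine HasFDerivAt.add_const _ (HasFDerivAt.fun_sum fun l _ => ?_)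
    exact ((hh _).hasDerivAt.comp_hasFDerivAt y (h1 l)).const_mul (a l)
  rw [partialDeriv, h2.fderiv]
  simp only [_root_.sum_apply, _root_.smul_apply,
    ContinuousLinearMap.proj_apply, smul_eq_mul, Pi.single_apply, mul_ite, mul_one, mul_zero,
    Finset.sum_ite_eq', Finset.mem_univ, if_true]
  exact Finset.sum_congr rfl fun l _ => by ring

lemma iterate_partialDeriv_ridge_sum (a b : ι → ℝ) (w : ι → Fin d → ℝ) (c : ℝ) {σ : ℝ → ℝ}
    (hσ : ContDiff ℝ ∞ σ) (p : Fin d) (j n : ℕ) :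
    (partialDeriv p)^[n] (fun y => ∑ l, a l * iteratedDeriv j σ (∑ q, w l q * y q + b l) + c) =
      fun y => ∑ l, a l * w l p ^ n * iteratedDeriv (j + n) σ (∑ q, w l q * y q + b l) +
        if n = 0 then c else 0 := by
  induction n with
  | zero => simp
  | succ n ih =>
    rw [Function.iterate_succ_apply', ih, partialDeriv_ridge_sum _ _ _ _
      (hσ.differentiable_iteratedDeriv _ (by exact_mod_cast WithTop.coe_lt_top _))]
    funext y
    simp only [← iteratedDeriv_succ, Nat.succ_ne_zero, if_false, add_zero, add_assoc, pow_succ,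
      mul_assoc]

/-- An arbitrary list replaces `List.finRange d` so that induction on it applies. -/
lemma foldr_partialDeriv_ridge_sum (a b : ι → ℝ) (w : ι → Fin d → ℝ) (c : ℝ) {σ : ℝ → ℝ}
    (hσ : ContDiff ℝ ∞ σ) (e : Fin d → ℕ) (L : List (Fin d)) :
    L.foldr (fun p h => (partialDeriv p)^[e p] h)
        (fun y => ∑ l, a l * σ (∑ q, w l q * y q + b l) + c) =
      fun y => ∑ l, a l * (L.map fun p => w l p ^ e p).prod *
          iteratedDeriv (L.map e).sum σ (∑ q, w l q * y q + b l) +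
        if ∀ p ∈ L, e p = 0 then c else 0 := by
  induction L with
  | nil => simp
  | cons p L ih =>
    rw [List.foldr_cons, ih, iterate_partialDeriv_ridge_sum _ _ _ _ hσ]
    funext y
    congr 1
    · refine Finset.sum_congr rfl fun l _ => ?_
      rw [List.map_cons, List.prod_cons, List.map_cons, List.sum_cons, add_comm (e p)]
      ring
    · simp only [List.mem_cons, forall_eq_or_imp, ite_and]

/-- The monomial `w^α`. -/
def monom {k : ℕ} (α : MultiIdx d k) (w : Fin d → ℝ) : ℝ := ∏ p, w p ^ (α.1 p : ℕ)

/-- The order `|α|`. -/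
def order {k : ℕ} (α : MultiIdx d k) : ℕ := ∑ p, (α.1 p : ℕ)

/-- The general index type serves both the whole network and, with `Unit`, a single feature. -/
lemma mixedDeriv_ridge_sum {k : ℕ} (α : MultiIdx d k) (a b : ι → ℝ) (w : ι → Fin d → ℝ) (c : ℝ)
    {σ : ℝ → ℝ} (hσ : ContDiff ℝ ∞ σ) (x : Fin d → ℝ) :
    mixedDeriv α (fun y => ∑ l, a l * σ (∑ q, w l q * y q + b l) + c) x =
      ∑ l, a l * (monom α (w l) * iteratedDeriv (order α) σ (∑ q, w l q * x q + b l)) +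
        if ∀ p, α.1 p = 0 then c else 0 := by
  rw [mixedDeriv, foldr_partialDeriv_ridge_sum a b w c hσ (fun p => (α.1 p : ℕ))]
  simp only [monom, order, Fin.prod_univ_def, Fin.sum_univ_def, List.mem_finRange, true_imp_iff,
    mul_assoc]
  simp only [Fin.ext_iff, Fin.val_zero]

lemma feature_eq {k : ℕ} {σ : ℝ → ℝ} (hσ : ContDiff ℝ ∞ σ) (x : Fin d → ℝ) (α : MultiIdx d k)
    (w : Fin d → ℝ) (b : ℝ) :
    feature σ x α w b = monom α w * iteratedDeriv (order α) σ (∑ p, w p * x p + b) := by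
  have := mixedDeriv_ridge_sum α (fun _ : Unit => 1) (fun _ => b) (fun _ => w) 0 hσ x
  simpa [feature] using this

end Ridge

lemma Phi_network {din dout k m : ℕ} {σ : ℝ → ℝ} (hσ : ContDiff ℝ ∞ σ)
    (θ : Param din dout m) (x : Fin din → ℝ) (e : Comp din dout k) :
    Phi k (network σ θ) x e =
      1 / √(m : ℝ) * ∑ l, W1 θ e.2 l * feature σ x e.1 (fun p => W0 θ l p) (b0 θ l) +
        if ∀ p, e.1.1 p = 0 then b1 θ e.2 else 0 := by
  have := mixedDeriv_ridge_sum e.1 (fun l => 1 / √(m : ℝ) * W1 θ e.2 l) (b0 θ)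
    (fun l p => W0 θ l p) (b1 θ e.2) hσ x
  simp only [Phi, network, feature_eq hσ, Finset.mul_sum, mul_assoc] at this ⊢
  exact this

lemma feature_zero {d k : ℕ} (σ : ℝ → ℝ) (x : Fin d → ℝ) (h : ∑ _p : Fin d, ((0 : Fin (k + 1)) : ℕ) ≤ k)
    (w : Fin d → ℝ) (b : ℝ) :
    feature (k := k) σ x ⟨fun _ => 0, h⟩ w b = σ (∑ p, w p * x p + b) := by
  have : ∀ (L : List (Fin d)) (g : (Fin d → ℝ) → ℝ),
      L.foldr (fun p h => (partialDeriv p)^[((0 : Fin (k + 1)) : ℕ)] h) g = g := by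
    intro L g
    induction L with
    | nil => rfl
    | cons p L ih => rw [List.foldr_cons, ih]; rfl
  simp only [feature, mixedDeriv, this]

/-- All rows of the linearised outputs have the same shape. -/
lemma linOutputs_eq {din dout k Nb Nr m : ℕ} {σ : ℝ → ℝ} (hσ : ContDiff ℝ ∞ σ)
    (xb : Fin Nb → Fin din → ℝ) (xr : Fin Nr → Fin din → ℝ) (θ : Param din dout m)
    (r : LinRow din dout k Nb Nr) :
    linOutputs σ xb xr θ r =
      1 / √(m : ℝ) * ∑ l, W1 θ (LinRow.comp r).2 l *
          feature σ (LinRow.point xb xr r) (LinRow.comp r).1 (fun p => W0 θ l p) (b0 θ l) +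
        if ∀ p, (LinRow.comp r).1.1 p = 0 then b1 θ (LinRow.comp r).2 else 0 := by
  rcases r with r | r
  · simp [linOutputs, LinRow.comp, LinRow.point, network, feature_zero]
  · exact Phi_network hσ θ (xr r.1) r.2

lemma contDiff_feature {d k : ℕ} {σ : ℝ → ℝ} (hσ : ContDiff ℝ ∞ σ) (x : Fin d → ℝ)
    (α : MultiIdx d k) :
    ContDiff ℝ ∞ (fun v : (Fin d → ℝ) × ℝ => feature σ x α v.1 v.2) := by
  simp only [feature_eq hσ, monom]
  have h1 : ContDiff ℝ ∞ (iteratedDeriv (order α) σ) :=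
    iteratedDeriv_eq_iterate (f := σ) ▸ hσ.iterate_deriv _
  refine ContDiff.mul ?_ (h1.comp ?_)
  · exact contDiff_prod fun p _ => ContDiff.pow (by fun_prop) _
  · fun_prop

/-! ### The Jacobian of the linearised outputs -/

section Jacobian

variable {din dout m : ℕ}

/-- The inner weights of one hidden neuron. -/
def neuron (l : Fin m) : Param din dout m →L[ℝ] (Fin din → ℝ) × ℝ :=
  (ContinuousLinearMap.pi fun p => ContinuousLinearMap.proj (Sum.inl (l, p))).prod
    (ContinuousLinearMap.proj (Sum.inr (Sum.inl l)))

lemma neuron_apply (l : Fin m) (θ : Param din dout m) :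
    neuron l θ = (fun p => W0 θ l p, b0 θ l) := rfl

/-- Common shape of all rows, to be used with `s = m^{-1/2}`, `t` the indicator of `α = 0`, and `F`
a feature. -/
lemma hasFDerivAt_neural_sum {F : (Fin din → ℝ) × ℝ → ℝ} (hF : Differentiable ℝ F) (s t : ℝ)
    (c : Fin dout) (θ : Param din dout m) :
    HasFDerivAt (fun θ : Param din dout m =>
        s * ∑ l, W1 θ c l * F (neuron l θ) + t * b1 θ c)
      (s • ∑ l, (W1 θ c l • (fderiv ℝ F (neuron l θ)).comp (neuron l) +
          F (neuron l θ) • ContinuousLinearMap.proj (R := ℝ) (φ := fun _ : ParamIdx din dout m => ℝ)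
            (Sum.inr (Sum.inr (Sum.inl (c, l))))) +
        t • ContinuousLinearMap.proj (R := ℝ) (φ := fun _ : ParamIdx din dout m => ℝ)
            (Sum.inr (Sum.inr (Sum.inr c)))) θ := by
  refine HasFDerivAt.add (HasFDerivAt.const_mul (HasFDerivAt.fun_sum fun l _ => ?_) s)
    ((hasFDerivAt_apply _ θ).const_mul t)
  exact (hasFDerivAt_apply _ θ).mul ((hF _).hasFDerivAt.comp θ (neuron l).hasFDerivAt)

lemma fderiv_prodMk_left {F : (Fin din → ℝ) × ℝ → ℝ} (hF : Differentiable ℝ F)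
    (w : Fin din → ℝ) (b : ℝ) (q : Fin din) :
    fderiv ℝ F (w, b) (Pi.single q 1, 0) = partialDeriv q (fun w => F (w, b)) w := by
  have h : HasFDerivAt (fun w => F (w, b)) _ w :=
    (hF (w, b)).hasFDerivAt.comp w (hasFDerivAt_prodMk_left w b)
  rw [partialDeriv, h.fderiv]
  simp

lemma fderiv_prodMk_right {F : (Fin din → ℝ) × ℝ → ℝ} (hF : Differentiable ℝ F)
    (w : Fin din → ℝ) (b : ℝ) :
    fderiv ℝ F (w, b) (0, 1) = deriv (fun b => F (w, b)) b := by
  have h : HasDerivAt (fun b => F (w, b)) _ b :=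
    (hF (w, b)).hasFDerivAt.comp_hasDerivAt b ((hasDerivAt_const b w).prodMk (hasDerivAt_id b))
  exact h.deriv.symm

lemma partialDeriv_W0 {F : (Fin din → ℝ) × ℝ → ℝ} (hF : Differentiable ℝ F) (s t : ℝ)
    (c : Fin dout) (θ : Param din dout m) (l : Fin m) (q : Fin din) :
    partialDeriv (Sum.inl (l, q)) (fun θ : Param din dout m =>
        s * ∑ l, W1 θ c l * F (neuron l θ) + t * b1 θ c) θ =
      s * W1 θ c l * partialDeriv q (fun w => F (w, b0 θ l)) (fun p => W0 θ l p) := by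
  have key : ∀ l', neuron (dout := dout) l' (Pi.single (Sum.inl (l, q)) 1) =
      if l' = l then ((Pi.single q 1 : Fin din → ℝ), (0 : ℝ)) else 0 := by
    intro l'
    split_ifs with h
    · subst h
      ext p
      · simp [neuron_apply, W0, Pi.single_apply]
      · simp [neuron_apply, b0]
    · ext p
      · simp [neuron_apply, W0, h]
      · simp [neuron_apply, b0]
  rw [partialDeriv, (hasFDerivAt_neural_sum hF s t c θ).fderiv]
  simp [key, apply_ite, ← fderiv_prodMk_left hF, neuron_apply, mul_assoc]

lemma partialDeriv_b0 {F : (Fin din → ℝ) × ℝ → ℝ} (hF : Differentiable ℝ F) (s t : ℝ)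
    (c : Fin dout) (θ : Param din dout m) (l : Fin m) :
    partialDeriv (Sum.inr (Sum.inl l)) (fun θ : Param din dout m =>
        s * ∑ l, W1 θ c l * F (neuron l θ) + t * b1 θ c) θ =
      s * W1 θ c l * deriv (fun b => F (fun p => W0 θ l p, b)) (b0 θ l) := by
  have key : ∀ l', neuron (din := din) (dout := dout) l' (Pi.single (Sum.inr (Sum.inl l)) 1) =
      if l' = l then ((0 : Fin din → ℝ), (1 : ℝ)) else 0 := by
    intro l'
    split_ifs with h
    · subst h
      ext p
      · simp [neuron_apply, W0]
      · simp [neuron_apply, b0]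
    · ext p
      · simp [neuron_apply, W0]
      · simp [neuron_apply, b0, h]
  rw [partialDeriv, (hasFDerivAt_neural_sum hF s t c θ).fderiv]
  simp [key, apply_ite, ← fderiv_prodMk_right hF, neuron_apply, mul_assoc]

lemma partialDeriv_W1 {F : (Fin din → ℝ) × ℝ → ℝ} (hF : Differentiable ℝ F) (s t : ℝ)
    (c : Fin dout) (θ : Param din dout m) (c' : Fin dout) (l : Fin m) :
    partialDeriv (Sum.inr (Sum.inr (Sum.inl (c', l)))) (fun θ : Param din dout m =>
        s * ∑ l, W1 θ c l * F (neuron l θ) + t * b1 θ c) θ =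
      if c = c' then s * F (neuron l θ) else 0 := by
  have key : ∀ l', neuron l' (Pi.single (Sum.inr (Sum.inr (Sum.inl (c', l)))) 1 :
      Param din dout m) = 0 := by
    intro l'
    ext p <;> simp [neuron_apply, W0, b0]
  rw [partialDeriv, (hasFDerivAt_neural_sum hF s t c θ).fderiv]
  by_cases h : c = c' <;> simp [key, Pi.single_apply, h]

lemma partialDeriv_b1 {F : (Fin din → ℝ) × ℝ → ℝ} (hF : Differentiable ℝ F) (s t : ℝ)
    (c : Fin dout) (θ : Param din dout m) (c' : Fin dout) :
    partialDeriv (Sum.inr (Sum.inr (Sum.inr c'))) (fun θ : Param din dout m =>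
        s * ∑ l, W1 θ c l * F (neuron l θ) + t * b1 θ c) θ =
      if c = c' then t else 0 := by
  have key : ∀ l', neuron l' (Pi.single (Sum.inr (Sum.inr (Sum.inr c'))) 1 :
      Param din dout m) = 0 := by
    intro l'
    ext p <;> simp [neuron_apply, W0, b0]
  rw [partialDeriv, (hasFDerivAt_neural_sum hF s t c θ).fderiv]
  by_cases h : c = c' <;> simp [key, h]

end Jacobian

/-! ### Global solutions of the eikonal equation are affine -/

section Eikonal

variable {E : Type*} [NormedAddCommGroup E] [InnerProductSpace ℝ E] [FiniteDimensional ℝ E]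

/-- Maximise `f y - a‖y - x‖` over the closed ball. An interior maximiser would have gradient of
norm at most `a < c`, so the maximum sits on the sphere; compare it with the value at `x`. -/
lemma exists_sphere_add_mul_le {f : E → ℝ} (hf : Differentiable ℝ f) {c : ℝ}
    (hc : ∀ x, ‖fderiv ℝ f x‖ = c) (x : E) {s a : ℝ} (hs : 0 < s) (ha : 0 ≤ a) (hac : a < c) :
    ∃ y, ‖y - x‖ = s ∧ f x + a * s ≤ f y := by
  have hcont : Continuous fun y => f y - a * ‖y - x‖ := by
    have := hf.continuous
    fun_prop
  obtain ⟨y, hy, hmax⟩ := (isCompact_closedBall x s).exists_isMaxOn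
    ⟨x, Metric.mem_closedBall_self hs.le⟩ hcont.continuousOn
  have hx := hmax (Metric.mem_closedBall_self hs.le)
  simp only [Set.mem_ofPred_eq, sub_self, norm_zero, mul_zero, sub_zero] at hx
  rw [Metric.mem_closedBall, dist_eq_norm] at hy
  rcases hy.lt_or_eq with hlt | heq
  · exfalso
    -- One-sided difference quotients and the triangle inequality suffice, so the case `y = x`,
    -- where the norm is not differentiable, needs no separate treatment.
    have hdir : ∀ v, fderiv ℝ f y v ≤ a * ‖v‖ := by
      intro v
      have h1 : HasDerivAt (fun t : ℝ => f (y + t • v)) (fderiv ℝ f y v) 0 := by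
        have h0 : HasFDerivAt f (fderiv ℝ f y) (y + (0 : ℝ) • v) := by
          simpa using (hf y).hasFDerivAt
        have h2 : HasDerivAt (fun t : ℝ => y + t • v) v 0 := by
          simpa using ((hasDerivAt_id (0 : ℝ)).smul_const v).const_add y
        exact h0.comp_hasDerivAt (0 : ℝ) h2
      have h3 := h1.tendsto_slope_zero_right
      refine le_of_tendsto h3 ?_
      have hball : ∀ᶠ t : ℝ in 𝓝 0, ‖y + t • v - x‖ < s := by
        have : Continuous fun t : ℝ => ‖y + t • v - x‖ := by fun_prop
        refine this.continuousAt.eventually_lt continuousAt_const ?_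
        simpa using hlt
      filter_upwards [hball.filter_mono nhdsWithin_le_nhds, self_mem_nhdsWithin] with t ht ht0
      rw [Set.mem_Ioi] at ht0
      have h4 : f (y + t • v) - a * ‖y + t • v - x‖ ≤ f y - a * ‖y - x‖ :=
        hmax (by rw [Metric.mem_closedBall, dist_eq_norm]; exact ht.le)
      have h5 : ‖y + t • v - x‖ ≤ ‖y - x‖ + t * ‖v‖ := by
        have : y + t • v - x = (y - x) + t • v := by abel
        rw [this]
        refine (norm_add_le _ _).trans_eq ?_
        rw [norm_smul, Real.norm_of_nonneg ht0.le]
      rw [smul_eq_mul, inv_mul_le_iff₀ ht0, zero_add, zero_smul, add_zero]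
      nlinarith
    have : ‖fderiv ℝ f y‖ ≤ a := by
      refine ContinuousLinearMap.opNorm_le_bound _ ha fun v => ?_
      rw [Real.norm_eq_abs, abs_le]
      have := hdir (-v)
      rw [map_neg, norm_neg] at this
      exact ⟨by linarith, hdir v⟩
    rw [hc] at this
    linarith
  · refine ⟨y, heq, ?_⟩
    rw [heq] at hx
    linarith

/-- Along the ray from `x` in the direction of the gradient `g`, `f` grows at the maximal rate `c`.
Since `f` is `c`-Lipschitz, `f y ≥ f x + c s - c‖x + (s/c) g - y‖` for all `s > 0`, and the right
side tends to `f x + ⟪g, y - x⟫` as `s → ∞`, as for a Busemann function. -/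
lemma add_fderiv_le_of_norm_fderiv_eq {f : E → ℝ} (hf : Differentiable ℝ f) {c : ℝ} (hc0 : 0 < c)
    (hc : ∀ x, ‖fderiv ℝ f x‖ = c) (x y : E) : f x + fderiv ℝ f x (y - x) ≤ f y := by
  have hlip : ∀ u v, f u - f v ≤ c * ‖u - v‖ := fun u v =>
    (le_abs_self _).trans <| Convex.norm_image_sub_le_of_norm_fderiv_le (fun z _ => hf z)
      (fun z _ => (hc z).le) convex_univ (Set.mem_univ v) (Set.mem_univ u)
  set g := (InnerProductSpace.toDual ℝ E).symm (fderiv ℝ f x) with hg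
  have hgv : ∀ v, fderiv ℝ f x v = inner ℝ g v := fun v => by
    rw [hg, InnerProductSpace.toDual_symm_apply]
  have hgn : ‖g‖ = c := by rw [hg, LinearIsometryEquiv.norm_map, hc]
  have hray : ∀ s : ℝ, 0 < s → f x + c * s ≤ f (x + (s / c) • g) := by
    intro s hs
    -- The point `y₀` only shows that the sphere is nonempty.
    obtain ⟨y₀, hy₀, -⟩ := exists_sphere_add_mul_le hf hc x hs le_rfl hc0
    obtain ⟨z, hz, hmax⟩ := (isCompact_sphere x s).exists_isMaxOn
      ⟨y₀, by rwa [mem_sphere_iff_norm]⟩ hf.continuous.continuousOn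
    rw [mem_sphere_iff_norm] at hz
    -- The maximum over the sphere dominates the bound for every rate `a < c`; `max a 0` meets the
    -- sign condition. Then `a` tends to `c`.
    have hfz : f x + c * s ≤ f z := by
      have : ∀ a, a < c → a ≤ (f z - f x) / s := by
        intro a hac
        obtain ⟨y, hy, hle⟩ :=
          exists_sphere_add_mul_le hf hc x hs (le_max_right a 0) (max_lt hac hc0)
        have := hmax (by rwa [mem_sphere_iff_norm] : y ∈ Metric.sphere x s)
        simp only [Set.mem_ofPred_eq] at this
        rw [le_div_iff₀ hs]
        nlinarith [le_max_left a 0]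
      have := le_of_forall_lt_imp_le_of_dense this
      rw [le_div_iff₀ hs] at this
      linarith
    -- From `x` to `z` the function gains at least `c s`, while beyond the parameter `t` it can gain
    -- at most `(1 - t) c s`; so it has already gained `t c s` there. Divide by `t` and let `t → 0`.
    have hinner : c * s ≤ inner ℝ g (z - x) := by
      have h1 : HasDerivAt (fun t : ℝ => f (x + t • (z - x))) (inner ℝ g (z - x)) 0 := by
        have h0 : HasFDerivAt f (fderiv ℝ f x) (x + (0 : ℝ) • (z - x)) := by
          simpa using (hf x).hasFDerivAt
        have h2 : HasDerivAt (fun t : ℝ => x + t • (z - x)) (z - x) 0 := by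
          simpa using ((hasDerivAt_id (0 : ℝ)).smul_const (z - x)).const_add x
        rw [← hgv]
        exact h0.comp_hasDerivAt (0 : ℝ) h2
      refine ge_of_tendsto h1.tendsto_slope_zero_right ?_
      have hlt1 : ∀ᶠ t : ℝ in 𝓝 0, t < 1 := eventually_lt_nhds zero_lt_one
      filter_upwards [hlt1.filter_mono nhdsWithin_le_nhds, self_mem_nhdsWithin] with t ht ht0
      rw [Set.mem_Ioi] at ht0
      rw [smul_eq_mul, le_inv_mul_iff₀ ht0, zero_add, zero_smul, add_zero]
      have h3 := hlip z (x + t • (z - x))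
      have h4 : z - (x + t • (z - x)) = (1 - t) • (z - x) := by module
      rw [h4, norm_smul, Real.norm_of_nonneg (by linarith), hz] at h3
      nlinarith
    -- Equality case of Cauchy–Schwarz: `‖g‖ = c`, `‖z - x‖ = s`, and the inner product is at least
    -- `c s`.
    have hzg : z - x = (s / c) • g := by
      rw [← sub_eq_zero, ← norm_eq_zero, ← sq_eq_zero_iff]
      refine le_antisymm ?_ (sq_nonneg _)
      rw [norm_sub_sq_real, hz, norm_smul, hgn, real_inner_smul_right, real_inner_comm,
        Real.norm_of_nonneg (by positivity), div_mul_cancel₀ _ hc0.ne']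
      have : s / c * (c * s) ≤ s / c * inner ℝ g (z - x) :=
        mul_le_mul_of_nonneg_left hinner (by positivity)
      have h5 : s / c * (c * s) = s ^ 2 := by field_simp
      nlinarith
    rw [← hzg, add_sub_cancel]
    exact hfz
  have hbound : ∀ s : ℝ, 0 < s →
      f x + inner ℝ g (y - x) - c * (‖y - x‖ ^ 2 / (2 * s)) ≤ f y := by
    intro s hs
    have h1 := hlip (x + (s / c) • g) y
    have h2 := hray s hs
    have h3 : ‖x + (s / c) • g - y‖ ^ 2 = s ^ 2 - 2 * (s / c) * inner ℝ g (y - x) + ‖y - x‖ ^ 2 := by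
      have : x + (s / c) • g - y = (s / c) • g - (y - x) := by abel
      rw [this, norm_sub_sq_real, norm_smul, hgn, real_inner_smul_left,
        Real.norm_of_nonneg (by positivity), div_mul_cancel₀ _ hc0.ne']
      ring
    -- The inequality `r ≤ (r² + s²) / (2s)` linearises the norm, and its error vanishes as `s → ∞`.
    have h4 : c * ‖x + (s / c) • g - y‖ ≤
        c * s - inner ℝ g (y - x) + c * (‖y - x‖ ^ 2 / (2 * s)) := by
      have h5 : ‖x + (s / c) • g - y‖ ≤ (‖x + (s / c) • g - y‖ ^ 2 + s ^ 2) / (2 * s) := by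
        rw [le_div_iff₀ (by positivity)]
        nlinarith [sq_nonneg (‖x + (s / c) • g - y‖ - s)]
      refine (mul_le_mul_of_nonneg_left h5 hc0.le).trans_eq ?_
      rw [h3]
      field_simp
      ring
    linarith
  rw [hgv]
  have hlim : Tendsto (fun s : ℝ => f x + inner ℝ g (y - x) - c * (‖y - x‖ ^ 2 / (2 * s))) atTop
      (𝓝 (f x + inner ℝ g (y - x) - c * 0)) := by
    refine tendsto_const_nhds.sub (Tendsto.const_mul c ?_)
    exact tendsto_const_nhds.div_atTop (tendsto_id.const_mul_atTop two_pos)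
  rw [mul_zero, sub_zero] at hlim
  exact le_of_tendsto hlim ((eventually_gt_atTop 0).mono hbound)

/-- The supporting inequality for `f` and the one for `-f` force equality with the tangent at `0`.
The case `c = 0` is separate because the rays are scaled by `1/c`. -/
theorem affine_of_norm_fderiv_eq {f : E → ℝ} (hf : Differentiable ℝ f) {c : ℝ}
    (hc : ∀ x, ‖fderiv ℝ f x‖ = c) : ∀ y, f y = fderiv ℝ f 0 y + f 0 := by
  intro y
  rcases (hc 0 ▸ norm_nonneg _ : 0 ≤ c).eq_or_lt with h0 | hpos
  · have hz : ∀ x, fderiv ℝ f x = 0 := fun x => norm_eq_zero.1 ((hc x).trans h0.symm)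
    rw [hz, is_const_of_fderiv_eq_zero hf hz y 0]
    simp
  · have h1 := add_fderiv_le_of_norm_fderiv_eq hf hpos hc 0 y
    have h2 := add_fderiv_le_of_norm_fderiv_eq (f := fun z => -f z) hf.neg hpos
      (fun x => by rw [fderiv_fun_neg, norm_neg, hc]) 0 y
    rw [fderiv_fun_neg] at h2
    simp only [sub_zero, _root_.neg_apply] at h1 h2
    linarith

end Eikonal

/-! ### Explicit form of the linearised kernel and the factorisation of the full kernel -/

section Factorisation

variable {din dout k Nb Nr m : ℕ}

/-- The indicator of `α = 0`. -/
def zeroInd {d k : ℕ} (α : MultiIdx d k) : ℝ := if ∀ p, α.1 p = 0 then 1 else 0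

lemma linOutputs_eq_neural_sum {σ : ℝ → ℝ} (hσ : ContDiff ℝ ∞ σ)
    (xb : Fin Nb → Fin din → ℝ) (xr : Fin Nr → Fin din → ℝ) (r : LinRow din dout k Nb Nr) :
    (fun θ : Param din dout m => linOutputs σ xb xr θ r) = fun θ =>
      1 / √(m : ℝ) * ∑ l, W1 θ (LinRow.comp r).2 l *
          (fun v : (Fin din → ℝ) × ℝ =>
            feature σ (LinRow.point xb xr r) (LinRow.comp r).1 v.1 v.2) (neuron l θ) +
        zeroInd (LinRow.comp r).1 * b1 θ (LinRow.comp r).2 := by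
  funext θ
  rw [linOutputs_eq hσ, zeroInd, ite_mul, one_mul, zero_mul]
  rfl

lemma differentiable_linOutputs {σ : ℝ → ℝ} (hσ : ContDiff ℝ ∞ σ)
    (xb : Fin Nb → Fin din → ℝ) (xr : Fin Nr → Fin din → ℝ) (r : LinRow din dout k Nb Nr) :
    Differentiable ℝ (fun θ : Param din dout m => linOutputs σ xb xr θ r) := by
  rw [linOutputs_eq_neural_sum hσ]
  exact fun θ => (hasFDerivAt_neural_sum
    ((contDiff_feature hσ _ _).differentiable (by simp)) _ _ _ θ).differentiableAt

lemma paramJacobian_outputs {σ : ℝ → ℝ} (hσ : ContDiff ℝ ∞ σ)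
    {R : (Comp din dout k → ℝ) → ℝ} (hR : Differentiable ℝ R)
    (xb : Fin Nb → Fin din → ℝ) (xr : Fin Nr → Fin din → ℝ) (θ : Param din dout m)
    (i : Row dout Nb Nr) (p : ParamIdx din dout m) :
    paramJacobian (outputs σ R xb xr) θ i p =
      ∑ r, lambdaR R Nb (phiVec σ xr k θ) i r * paramJacobian (linOutputs σ xb xr) θ r p := by
  rw [Fintype.sum_sum_type]
  rcases i with i | i
  · simp [lambdaR, Matrix.one_apply, paramJacobian, outputs, linOutputs]
  · have hphi : HasFDerivAt (fun θ' : Param din dout m => Phi k (network σ θ') (xr i))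
        (ContinuousLinearMap.pi fun e =>
          fderiv ℝ (fun θ' => linOutputs (k := k) σ xb xr θ' (Sum.inr (i, e))) θ) θ :=
      hasFDerivAt_pi.2 fun e => (differentiable_linOutputs hσ xb xr (Sum.inr (i, e)) θ).hasFDerivAt
    have hcomp := (hR (Phi k (network σ θ) (xr i))).hasFDerivAt.comp θ hphi
    have h1 : paramJacobian (outputs σ R xb xr) θ (Sum.inr i) p =
        fderiv ℝ R (Phi k (network σ θ) (xr i)) (fun e =>
          partialDeriv p (fun θ' => linOutputs (k := k) σ xb xr θ' (Sum.inr (i, e))) θ) := by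
      simp only [paramJacobian, Matrix.of_apply, partialDeriv, outputs, Sum.elim_inr]
      exact congrArg (fun L => L (Pi.single p 1)) hcomp.fderiv
    rw [h1, ← ContinuousLinearMap.coe_coe, LinearMap.pi_apply_eq_sum_univ]
    have hl : ∀ r, lambdaR R Nb (phiVec σ xr k θ) (Sum.inr i) (Sum.inl r) = 0 := fun _ => rfl
    have hr : ∀ i' e, lambdaR R Nb (phiVec σ xr k θ) (Sum.inr i) (Sum.inr (i', e)) =
        if i = i' then partialDeriv e R (Phi k (network σ θ) (xr i)) else 0 := fun _ _ => rfl
    have hs : ∀ e : Comp din dout k, (fun j => if e = j then (1 : ℝ) else 0) = Pi.single e 1 := by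
      intro e
      funext j
      simp only [Pi.single_apply, eq_comm]
    simp only [hl, hs, zero_mul, Finset.sum_const_zero, zero_add, smul_eq_mul]
    symm
    rw [Fintype.sum_prod_type, Finset.sum_eq_single i]
    · exact Finset.sum_congr rfl fun e _ => by
        rw [hr, if_pos rfl, mul_comm]
        rfl
    · intro i' _ hne
      exact Finset.sum_eq_zero fun e _ => by rw [hr, if_neg hne.symm, zero_mul]
    · exact fun h => absurd (Finset.mem_univ i) h

lemma linNtk_eq_sum (σ : ℝ → ℝ) (xb : Fin Nb → Fin din → ℝ) (xr : Fin Nr → Fin din → ℝ)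
    (θ : Param din dout m) (r q : LinRow din dout k Nb Nr) :
    linNtk σ xb xr θ r q =
      ∑ p, paramJacobian (linOutputs σ xb xr) θ r p * paramJacobian (linOutputs σ xb xr) θ q p :=
  rfl

lemma ntk_eq_sum (σ : ℝ → ℝ) (R : (Comp din dout k → ℝ) → ℝ) (xb : Fin Nb → Fin din → ℝ)
    (xr : Fin Nr → Fin din → ℝ) (θ : Param din dout m) (i j : Row dout Nb Nr) :
    ntk σ R xb xr θ i j =
      ∑ p, paramJacobian (outputs σ R xb xr) θ i p * paramJacobian (outputs σ R xb xr) θ j p :=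
  rfl

lemma limitNtk_eq_sum (σ : ℝ → ℝ) (R : (Comp din dout k → ℝ) → ℝ) (xb : Fin Nb → Fin din → ℝ)
    (xr : Fin Nr → Fin din → ℝ) (G : Fin Nr × Comp din dout k → ℝ) (i j : Row dout Nb Nr) :
    limitNtk σ R xb xr G i j =
      ∑ q, (∑ r, lambdaR R Nb G i r * limitLinNtk σ xb xr r q) * lambdaR R Nb G j q :=
  rfl

/-- Entrywise, `K` is a continuous function of the pair `(Φ, K_Φ)`; this form feeds the Slutsky
argument. -/
lemma ntk_apply {σ : ℝ → ℝ} (hσ : ContDiff ℝ ∞ σ)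
    {R : (Comp din dout k → ℝ) → ℝ} (hR : Differentiable ℝ R)
    (xb : Fin Nb → Fin din → ℝ) (xr : Fin Nr → Fin din → ℝ) (θ : Param din dout m)
    (i j : Row dout Nb Nr) :
    ntk σ R xb xr θ i j =
      ∑ q, (∑ r, lambdaR R Nb (phiVec σ xr k θ) i r * linNtk σ xb xr θ r q) *
        lambdaR R Nb (phiVec σ xr k θ) j q := by
  simp only [ntk_eq_sum, linNtk_eq_sum, paramJacobian_outputs hσ hR, Finset.sum_mul,
    Finset.mul_sum]
  rw [Finset.sum_comm]
  refine Finset.sum_congr rfl fun q _ => ?_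
  rw [Finset.sum_comm]
  exact Finset.sum_congr rfl fun r _ => Finset.sum_congr rfl fun p _ => by ring

theorem ntk_eq_mul_linNtk_mul {σ : ℝ → ℝ} (hσ : ContDiff ℝ ∞ σ)
    {R : (Comp din dout k → ℝ) → ℝ} (hR : Differentiable ℝ R)
    (xb : Fin Nb → Fin din → ℝ) (xr : Fin Nr → Fin din → ℝ) (θ : Param din dout m) :
    ntk σ R xb xr θ = lambdaR R Nb (phiVec σ xr k θ) * linNtk (k := k) σ xb xr θ *
      (lambdaR R Nb (phiVec σ xr k θ))ᵀ := by
  funext i j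
  exact ntk_apply hσ hR xb xr θ i j

/-- The parameters attached to one hidden neuron: `((w, b), u)` with `u` the outer weights. -/
abbrev NeuronParam (din dout : ℕ) : Type := ((Fin din → ℝ) × ℝ) × (Fin dout → ℝ)

/-- The product of gradients of two features with respect to `(w, b)`. -/
def gradProd {d k : ℕ} (σ : ℝ → ℝ) (x y : Fin d → ℝ) (α β : MultiIdx d k)
    (v : (Fin d → ℝ) × ℝ) : ℝ :=
  deriv (fun b => feature σ x α v.1 b) v.2 * deriv (fun b => feature σ y β v.1 b) v.2 +
    ∑ p, partialDeriv p (fun w => feature σ x α w v.2) v.1 *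
      partialDeriv p (fun w => feature σ y β w v.2) v.1

/-- The contribution of one hidden neuron to an entry of the linearised kernel. -/
def neuronKernel {d k dout : ℕ} (σ : ℝ → ℝ) (x y : Fin d → ℝ) (e f : Comp d dout k)
    (η : NeuronParam d dout) : ℝ :=
  η.2 e.2 * η.2 f.2 * gradProd σ x y e.1 f.1 η.1 +
    if e.2 = f.2 then feature σ x e.1 η.1.1 η.1.2 * feature σ y f.1 η.1.1 η.1.2 else 0

/-- The sum over parameters is regrouped by neuron. Two factors `m^{-1/2}` make the prefactor `1/m`,
so this is an empirical mean; the derivatives in `b¹` give the constant. -/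
lemma linNtk_apply {σ : ℝ → ℝ} (hσ : ContDiff ℝ ∞ σ)
    (xb : Fin Nb → Fin din → ℝ) (xr : Fin Nr → Fin din → ℝ) (θ : Param din dout m)
    (r q : LinRow din dout k Nb Nr) :
    linNtk σ xb xr θ r q =
      1 / (m : ℝ) * ∑ l, neuronKernel σ (LinRow.point xb xr r) (LinRow.point xb xr q)
          (LinRow.comp r) (LinRow.comp q) (neuron l θ, fun c => W1 θ c l) +
        if (LinRow.comp r).2 = (LinRow.comp q).2 then
          zeroInd (LinRow.comp r).1 * zeroInd (LinRow.comp q).1 else 0 := by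
  have hd : ∀ r : LinRow din dout k Nb Nr, Differentiable ℝ (fun v : (Fin din → ℝ) × ℝ =>
      feature σ (LinRow.point xb xr r) (LinRow.comp r).1 v.1 v.2) := fun r =>
    (contDiff_feature hσ _ _).differentiable (by simp)
  have hs : 1 / √(m : ℝ) * (1 / √(m : ℝ)) = 1 / m := by
    rw [div_mul_div_comm, Real.mul_self_sqrt (Nat.cast_nonneg m), one_mul]
  simp only [linNtk_eq_sum, paramJacobian, Matrix.of_apply,
    linOutputs_eq_neural_sum hσ, Fintype.sum_sum_type, Fintype.sum_prod_type,
    partialDeriv_W0 (hd _), partialDeriv_b0 (hd _), partialDeriv_W1 (hd _), partialDeriv_b1 (hd _)]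
  simp only [neuronKernel, gradProd, neuron_apply, ← hs]
  generalize 1 / √(m : ℝ) = s
  by_cases h : (LinRow.comp r).2 = (LinRow.comp q).2
  · simp only [h, if_true, mul_ite, ite_mul, zero_mul, mul_zero, Finset.sum_add_distrib,
      Finset.mul_sum, mul_add, Finset.sum_ite_irrel, Finset.sum_const_zero, Finset.sum_ite_eq,
      Finset.mem_univ]
    rw [← add_assoc, ← add_assoc]
    congr 1
    congr 1
    · rw [add_comm]
      congr 1
      · exact Finset.sum_congr rfl fun _ _ => by ring
      · exact Finset.sum_congr rfl fun _ _ => Finset.sum_congr rfl fun _ _ => by ring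
    · exact Finset.sum_congr rfl fun _ _ => by ring
  -- Rows with different output coordinates share no outer weight and no outer bias.
  · have h' : ∀ c, (LinRow.comp r).2 = c → (LinRow.comp q).2 ≠ c := fun c hc hq => h (hc.trans hq.symm)
    have hz : ∀ (c : Fin dout) (a b : ℝ), (if (LinRow.comp r).2 = c then a else 0) *
        (if (LinRow.comp q).2 = c then b else 0) = 0 := by
      intro c a b
      by_cases hc : (LinRow.comp r).2 = c
      · rw [if_neg (h' c hc), mul_zero]
      · rw [if_neg hc, zero_mul]
    simp only [h, if_false, hz, Finset.sum_const_zero, add_zero, Finset.sum_add_distrib,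
      Finset.mul_sum, mul_add]
    rw [add_comm]
    congr 1
    · exact Finset.sum_congr rfl fun _ _ => by ring
    · exact Finset.sum_congr rfl fun _ _ => Finset.sum_congr rfl fun _ _ => by ring

end Factorisation

/-! ### Functions of polynomial growth and their Gaussian moments -/

section PolyGrowth

variable {V : Type*} [NormedAddCommGroup V]

/-- `f` grows at most polynomially. -/
def PolyGrowth (f : V → ℝ) : Prop := ∃ (C : ℝ) (n : ℕ), ∀ v, |f v| ≤ C * (1 + ‖v‖) ^ n

lemma polyGrowth_const (c : ℝ) : PolyGrowth (fun _ : V => c) := ⟨|c|, 0, fun v => by simp⟩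

lemma PolyGrowth.of_bounded {f : V → ℝ} {C : ℝ} (h : ∀ v, |f v| ≤ C) : PolyGrowth f :=
  ⟨C, 0, fun v => by simpa using h v⟩

lemma polyGrowth_clm [NormedSpace ℝ V] (L : V →L[ℝ] ℝ) : PolyGrowth (fun v => L v) :=
  ⟨‖L‖, 1, fun v => (L.le_opNorm v).trans (by nlinarith [norm_nonneg L])⟩

lemma PolyGrowth.mul {f g : V → ℝ} (hf : PolyGrowth f) (hg : PolyGrowth g) :
    PolyGrowth (fun v => f v * g v) := by
  obtain ⟨C, n, hf⟩ := hf
  obtain ⟨D, j, hg⟩ := hg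
  refine ⟨C * D, n + j, fun v => ?_⟩
  rw [abs_mul, pow_add]
  calc |f v| * |g v| ≤ (C * (1 + ‖v‖) ^ n) * (D * (1 + ‖v‖) ^ j) :=
        mul_le_mul (hf v) (hg v) (abs_nonneg _) ((abs_nonneg _).trans (hf v))
    _ = _ := by ring

lemma PolyGrowth.add {f g : V → ℝ} (hf : PolyGrowth f) (hg : PolyGrowth g) :
    PolyGrowth (fun v => f v + g v) := by
  obtain ⟨C, n, hf⟩ := hf
  obtain ⟨D, j, hg⟩ := hg
  have hC : 0 ≤ C := by simpa using (abs_nonneg _).trans (hf 0)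
  have hD : 0 ≤ D := by simpa using (abs_nonneg _).trans (hg 0)
  refine ⟨C + D, max n j, fun v => ?_⟩
  have h1 : 1 ≤ 1 + ‖v‖ := by linarith [norm_nonneg v]
  calc |f v + g v| ≤ |f v| + |g v| := abs_add_le _ _
    _ ≤ C * (1 + ‖v‖) ^ n + D * (1 + ‖v‖) ^ j := add_le_add (hf v) (hg v)
    _ ≤ C * (1 + ‖v‖) ^ max n j + D * (1 + ‖v‖) ^ max n j := by
        gcongr
        · exact le_max_left _ _
        · exact le_max_right _ _
    _ = _ := by ring

lemma PolyGrowth.sum {ι : Type*} {s : Finset ι} {f : ι → V → ℝ} (hf : ∀ i ∈ s, PolyGrowth (f i)) :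
    PolyGrowth (fun v => ∑ i ∈ s, f i v) := by
  classical
  induction s using Finset.induction_on with
  | empty => simpa using polyGrowth_const 0
  | insert a s ha ih =>
    simp only [Finset.sum_insert ha]
    exact (hf a (Finset.mem_insert_self a s)).add
      (ih fun i hi => hf i (Finset.mem_insert_of_mem hi))

lemma PolyGrowth.pow {f : V → ℝ} (hf : PolyGrowth f) (n : ℕ) : PolyGrowth (fun v => f v ^ n) := by
  induction n with
  | zero => simpa using polyGrowth_const 1
  | succ n ih => simpa only [pow_succ] using ih.mul hf

lemma PolyGrowth.prod {ι : Type*} {s : Finset ι} {f : ι → V → ℝ}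
    (hf : ∀ i ∈ s, PolyGrowth (f i)) : PolyGrowth (fun v => ∏ i ∈ s, f i v) := by
  classical
  induction s using Finset.induction_on with
  | empty => simpa using polyGrowth_const 1
  | insert a s ha ih =>
    simp only [Finset.prod_insert ha]
    exact (hf a (Finset.mem_insert_self a s)).mul
      (ih fun i hi => hf i (Finset.mem_insert_of_mem hi))

lemma PolyGrowth.comp_clm [NormedSpace ℝ V] {V' : Type*} [NormedAddCommGroup V'] [NormedSpace ℝ V']
    {f : V → ℝ} (hf : PolyGrowth f) (L : V' →L[ℝ] V) : PolyGrowth (fun v => f (L v)) := by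
  obtain ⟨C, n, hf⟩ := hf
  have hC : 0 ≤ C := by simpa using (abs_nonneg _).trans (hf 0)
  refine ⟨C * (1 + ‖L‖) ^ n, n, fun v => (hf _).trans ?_⟩
  rw [mul_assoc, ← mul_pow]
  refine mul_le_mul_of_nonneg_left (pow_le_pow_left₀ (by positivity) ?_ n) hC
  nlinarith [L.le_opNorm v, norm_nonneg L, norm_nonneg v]

/-- A Gaussian measure has moments of every order. Hölder's inequality with exponents `2p, 2p`
raises the power of `1 + ‖v‖` by one, which is why the induction quantifies over all `p`. -/
lemma PolyGrowth.memLp [NormedSpace ℝ V] [CompleteSpace V] [MeasurableSpace V] [BorelSpace V]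
    [SecondCountableTopology V] {f : V → ℝ} (hf : PolyGrowth f) (hc : Continuous f)
    (μ : Measure V) [IsGaussian μ] (p : ENNReal) (hp : p ≠ ⊤) : MemLp f p μ := by
  obtain ⟨C, n, hf⟩ := hf
  have h1 : ∀ n : ℕ, ∀ p : ENNReal, p ≠ ⊤ → MemLp (fun v : V => (1 + ‖v‖) ^ n) p μ := by
    intro n
    induction n with
    | zero => intro p _; simpa using memLp_const (1 : ℝ)
    | succ n ih =>
      intro p hp
      simp only [pow_succ]
      have h2 : MemLp (fun v : V => 1 + ‖v‖) (2 * p) μ :=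
        (memLp_const (1 : ℝ)).add
          (IsGaussian.memLp_id μ (2 * p) (ENNReal.mul_ne_top (by simp) hp)).norm
      refine h2.mul (ih (2 * p) (ENNReal.mul_ne_top (by simp) hp)) (hpqr := ⟨?_⟩)
      rw [ENNReal.mul_inv (by simp) (by simp), ← two_mul, ← mul_assoc,
        ENNReal.mul_inv_cancel (by simp) (by simp), one_mul]
  refine ((h1 n p hp).const_mul C).mono' hc.aestronglyMeasurable (ae_of_all _ fun v => ?_)
  exact hf v

end PolyGrowth

/-! ### Growth of the features -/

section FeatureGrowth

variable {d k : ℕ}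

instance isGaussian_pi_gaussianReal {ι : Type*} [Fintype ι] :
    IsGaussian (Measure.pi fun _ : ι => gaussianReal 0 1) := by
  have h : Measure.pi (fun _ : ι => gaussianReal 0 1) =
      (stdGaussian (EuclideanSpace ℝ ι)).map (EuclideanSpace.equiv ι ℝ) := by
    rw [← map_pi_eq_stdGaussian, Measure.map_map (by fun_prop) (by fun_prop)]
    exact Measure.map_id.symm
  rw [h]
  infer_instance

/-- The bound on the derivatives of the activation. -/
def BoundedDerivs (k : ℕ) (σ : ℝ → ℝ) : Prop :=
  ∃ C : ℝ, ∀ i : ℕ, 1 ≤ i → i ≤ k + 1 → ∀ s : ℝ, |iteratedDeriv i σ s| ≤ C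

/-- The activation itself may be unbounded; a bounded `σ'` gives it linear growth. Order `k + 1` is
needed for the gradients of features. -/
lemma polyGrowth_iteratedDeriv {σ : ℝ → ℝ} (hσ : ContDiff ℝ ∞ σ) (hb : BoundedDerivs k σ)
    {j : ℕ} (hj : j ≤ k + 1) : PolyGrowth (iteratedDeriv j σ) := by
  obtain ⟨C, hC⟩ := hb
  rcases Nat.eq_zero_or_pos j with rfl | hpos
  · refine ⟨|σ 0| + C, 1, fun s => ?_⟩
    have h1 : ‖σ s - σ 0‖ ≤ C * ‖s - 0‖ :=
      Convex.norm_image_sub_le_of_norm_deriv_le (fun x _ => (hσ.differentiable (by simp)) x)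
        (fun x _ => by simpa using hC 1 le_rfl (by omega) x) convex_univ (Set.mem_univ _)
        (Set.mem_univ _)
    rw [sub_zero, Real.norm_eq_abs] at h1
    have h2 : |σ s| ≤ |σ s - σ 0| + |σ 0| := by simpa using abs_add_le (σ s - σ 0) (σ 0)
    have h3 : 0 ≤ C := (abs_nonneg _).trans (hC 1 le_rfl (by omega) 0)
    rw [iteratedDeriv_zero, pow_one]
    nlinarith [norm_nonneg s, abs_nonneg (σ 0), mul_nonneg (abs_nonneg (σ 0)) (norm_nonneg s)]
  · exact .of_bounded (hC j hpos hj)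

/-- The preactivation `w · x + b` as a linear function of `(w, b)`. -/
def preact (x : Fin d → ℝ) : (Fin d → ℝ) × ℝ →L[ℝ] ℝ :=
  ∑ p, x p • (ContinuousLinearMap.proj p).comp (ContinuousLinearMap.fst ℝ (Fin d → ℝ) ℝ) +
    ContinuousLinearMap.snd ℝ (Fin d → ℝ) ℝ

lemma preact_apply (x : Fin d → ℝ) (v : (Fin d → ℝ) × ℝ) :
    preact x v = ∑ p, v.1 p * x p + v.2 := by
  simp [preact, _root_.sum_apply, mul_comm]

lemma feature_eq_preact {σ : ℝ → ℝ} (hσ : ContDiff ℝ ∞ σ) (x : Fin d → ℝ) (α : MultiIdx d k)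
    (v : (Fin d → ℝ) × ℝ) :
    feature σ x α v.1 v.2 = monom α v.1 * iteratedDeriv (order α) σ (preact x v) := by
  rw [feature_eq hσ, preact_apply]

lemma order_le (α : MultiIdx d k) : order α ≤ k := α.2

lemma polyGrowth_coord (p : Fin d) : PolyGrowth (fun v : (Fin d → ℝ) × ℝ => v.1 p) :=
  polyGrowth_clm ((ContinuousLinearMap.proj p).comp (ContinuousLinearMap.fst ℝ (Fin d → ℝ) ℝ))

lemma polyGrowth_monom (α : MultiIdx d k) :
    PolyGrowth (fun v : (Fin d → ℝ) × ℝ => monom α v.1) :=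
  PolyGrowth.prod fun p _ => (polyGrowth_coord p).pow _

lemma polyGrowth_feature {σ : ℝ → ℝ} (hσ : ContDiff ℝ ∞ σ) (hb : BoundedDerivs k σ)
    (x : Fin d → ℝ) (α : MultiIdx d k) :
    PolyGrowth (fun v : (Fin d → ℝ) × ℝ => feature σ x α v.1 v.2) := by
  simp only [feature_eq_preact hσ]
  exact (polyGrowth_monom α).mul
    ((polyGrowth_iteratedDeriv hσ hb ((order_le α).trans (Nat.le_succ k))).comp_clm (preact x))

lemma hasDerivAt_iteratedDeriv {σ : ℝ → ℝ} (hσ : ContDiff ℝ ∞ σ) (n : ℕ) (s : ℝ) :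
    HasDerivAt (iteratedDeriv n σ) (iteratedDeriv (n + 1) σ s) s := by
  rw [iteratedDeriv_succ]
  exact (hσ.differentiable_iteratedDeriv n (by exact_mod_cast WithTop.coe_lt_top _) s).hasDerivAt

lemma hasFDerivAt_feature {σ : ℝ → ℝ} (hσ : ContDiff ℝ ∞ σ) (x : Fin d → ℝ) (α : MultiIdx d k)
    (v : (Fin d → ℝ) × ℝ) :
    HasFDerivAt (fun v : (Fin d → ℝ) × ℝ => feature σ x α v.1 v.2)
      (monom α v.1 • iteratedDeriv (order α + 1) σ (preact x v) • preact x +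
        iteratedDeriv (order α) σ (preact x v) •
          ∑ p, (∏ q ∈ Finset.univ.erase p, v.1 q ^ (α.1 q : ℕ)) •
            ((α.1 p : ℕ) * v.1 p ^ ((α.1 p : ℕ) - 1)) •
              (ContinuousLinearMap.proj p).comp (ContinuousLinearMap.fst ℝ (Fin d → ℝ) ℝ)) v := by
  simp only [feature_eq_preact hσ]
  refine HasFDerivAt.mul ?_ ?_
  · refine HasFDerivAt.finsetProd fun p _ => ?_
    have h1 : HasFDerivAt (fun v : (Fin d → ℝ) × ℝ => v.1 p)
      ((ContinuousLinearMap.proj p).comp (ContinuousLinearMap.fst ℝ (Fin d → ℝ) ℝ)) v :=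
      ContinuousLinearMap.hasFDerivAt
        ((ContinuousLinearMap.proj p).comp (ContinuousLinearMap.fst ℝ (Fin d → ℝ) ℝ))
    exact (hasDerivAt_pow (α.1 p : ℕ) (v.1 p)).comp_hasFDerivAt v h1
  · exact (hasDerivAt_iteratedDeriv hσ _ _).comp_hasFDerivAt v (preact x).hasFDerivAt

lemma polyGrowth_fderiv_feature {σ : ℝ → ℝ} (hσ : ContDiff ℝ ∞ σ) (hb : BoundedDerivs k σ)
    (x : Fin d → ℝ) (α : MultiIdx d k) (u : (Fin d → ℝ) × ℝ) :
    PolyGrowth (fun v : (Fin d → ℝ) × ℝ =>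
      fderiv ℝ (fun v : (Fin d → ℝ) × ℝ => feature σ x α v.1 v.2) v u) := by
  have h : ∀ v, fderiv ℝ (fun v : (Fin d → ℝ) × ℝ => feature σ x α v.1 v.2) v u =
      monom α v.1 * (iteratedDeriv (order α + 1) σ (preact x v) * preact x u) +
        iteratedDeriv (order α) σ (preact x v) *
          ∑ p, (∏ q ∈ Finset.univ.erase p, v.1 q ^ (α.1 q : ℕ)) *
            (((α.1 p : ℕ) * v.1 p ^ ((α.1 p : ℕ) - 1)) * u.1 p) := by
    intro v
    rw [(hasFDerivAt_feature hσ x α v).fderiv]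
    simp [_root_.sum_apply]
  simp only [h]
  have hk := order_le α
  refine ((polyGrowth_monom α).mul (PolyGrowth.mul ?_ (polyGrowth_const _))).add
    (PolyGrowth.mul ?_ (PolyGrowth.sum fun p _ => PolyGrowth.mul ?_ ?_))
  · exact (polyGrowth_iteratedDeriv hσ hb (by omega)).comp_clm (preact x)
  · exact (polyGrowth_iteratedDeriv hσ hb (by omega)).comp_clm (preact x)
  · exact PolyGrowth.prod fun q _ => (polyGrowth_coord q).pow _
  · exact ((polyGrowth_const _).mul ((polyGrowth_coord p).pow _)).mul (polyGrowth_const _)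

lemma continuous_fderiv_feature {σ : ℝ → ℝ} (hσ : ContDiff ℝ ∞ σ)
    (x : Fin d → ℝ) (α : MultiIdx d k) (u : (Fin d → ℝ) × ℝ) :
    Continuous (fun v : (Fin d → ℝ) × ℝ =>
      fderiv ℝ (fun v : (Fin d → ℝ) × ℝ => feature σ x α v.1 v.2) v u) :=
  ((contDiff_feature hσ x α).continuous_fderiv (by simp)).clm_apply continuous_const

end FeatureGrowth

/-! ### The law of the parameters, neuron by neuron -/

section Law

variable {din dout m : ℕ}

/-- The law of the parameters attached to one hidden neuron. -/
abbrev unitLaw (din dout : ℕ) : Measure (NeuronParam din dout) :=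
  (neuronLaw din).prod (Measure.pi fun _ => gaussianReal 0 1)

/-- The parameters grouped by hidden neurons, together with the outer bias. -/
def splitParam (θ : Param din dout m) : (Fin m → NeuronParam din dout) × (Fin dout → ℝ) :=
  (fun l => (neuron l θ, fun c => W1 θ c l), b1 θ)

/-- The inverse of `splitParam`. -/
def joinParam (η : (Fin m → NeuronParam din dout) × (Fin dout → ℝ)) : Param din dout m :=
  Sum.elim (fun lp => (η.1 lp.1).1.1 lp.2) (Sum.elim (fun l => (η.1 l).1.2)
    (Sum.elim (fun cl => (η.1 cl.2).2 cl.1) η.2))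

lemma measurable_joinParam :
    Measurable (joinParam : (Fin m → NeuronParam din dout) × (Fin dout → ℝ) → _) := by
  refine measurable_pi_iff.2 ?_
  rintro (⟨l, p⟩ | l | ⟨c, l⟩ | c) <;> simp only [joinParam, Sum.elim_inl, Sum.elim_inr] <;> fun_prop

lemma measurable_splitParam :
    Measurable (splitParam : Param din dout m → _) := by
  refine Measurable.prodMk (measurable_pi_iff.2 fun l => Measurable.prodMk ?_ ?_) ?_
  · exact (neuron l).continuous.measurable
  · exact measurable_pi_iff.2 fun c => measurable_pi_apply _
  · exact measurable_pi_iff.2 fun c => measurable_pi_apply _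

/-- A product measure is determined by its values on boxes, and `joinParam` pulls boxes back to
boxes with the same factors. -/
lemma map_joinParam :
    ((Measure.pi fun _ : Fin m => unitLaw din dout).prod
      (Measure.pi fun _ : Fin dout => gaussianReal 0 1)).map joinParam =
      gaussianInit din dout m := by
  symm
  refine Measure.pi_eq fun s hs => ?_
  rw [Measure.map_apply measurable_joinParam (MeasurableSet.univ_pi hs)]
  have : joinParam ⁻¹' Set.pi Set.univ s =
      (Set.pi Set.univ fun l : Fin m =>
        ((Set.pi Set.univ fun p => s (Sum.inl (l, p))) ×ˢ s (Sum.inr (Sum.inl l))) ×ˢ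
          (Set.pi Set.univ fun c => s (Sum.inr (Sum.inr (Sum.inl (c, l)))))) ×ˢ
      (Set.pi Set.univ fun c => s (Sum.inr (Sum.inr (Sum.inr c)))) := by
    ext η
    simp only [Set.mem_preimage, Set.mem_pi, Set.mem_univ, true_imp_iff, Set.mem_prod, Sum.forall,
      Prod.forall, joinParam, Sum.elim_inl, Sum.elim_inr]
    exact ⟨fun h => ⟨fun l => ⟨⟨h.1 l, h.2.1 l⟩, fun c => h.2.2.1 c l⟩, h.2.2.2⟩,
      fun h => ⟨fun l => (h.1 l).1.1, fun l => (h.1 l).1.2, fun c l => (h.1 l).2 c, h.2⟩⟩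
  rw [this, Measure.prod_prod, Measure.pi_pi, Measure.pi_pi]
  simp only [Measure.prod_prod, Measure.pi_pi, Fintype.prod_sum_type, Fintype.prod_prod_type,
    Finset.prod_mul_distrib]
  rw [Finset.prod_comm (f := fun c l => (gaussianReal 0 1) (s (Sum.inr (Sum.inr (Sum.inl (c, l))))))]
  ring

lemma measurePreserving_splitParam :
    MeasurePreserving (splitParam : Param din dout m → _) (gaussianInit din dout m)
      ((Measure.pi fun _ : Fin m => unitLaw din dout).prod
        (Measure.pi fun _ : Fin dout => gaussianReal 0 1)) := by
  refine ⟨measurable_splitParam, ?_⟩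
  rw [← map_joinParam, Measure.map_map measurable_splitParam measurable_joinParam]
  exact Measure.map_id

end Law

/-! ### The weak law of large numbers -/

section WeakLaw

variable {X : Type*} [MeasurableSpace X]

/-- Different widths `m` are not coupled, so the statement lives on a separate product space for
each `m`. Chebyshev's inequality with variance `Var[f; μ] / m` proves it. -/
lemma tendsto_measure_average_sub_integral (μ : Measure X) [IsProbabilityMeasure μ] {f : X → ℝ}
    (hf : MemLp f 2 μ) {ε : ℝ} (hε : 0 < ε) :
    Tendsto (fun m : ℕ => (Measure.pi fun _ : Fin m => μ)
      {x | ε ≤ |1 / (m : ℝ) * ∑ l, f (x l) - ∫ y, f y ∂μ|}) atTop (𝓝 0) := by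
  have hbound : ∀ m : ℕ, 0 < m → (Measure.pi fun _ : Fin m => μ)
      {x | ε ≤ |1 / (m : ℝ) * ∑ l, f (x l) - ∫ y, f y ∂μ|} ≤
        ENNReal.ofReal (Var[f; μ] / ε ^ 2 / m) := by
    intro m hm
    have hm' : (m : ℝ) ≠ 0 := by positivity
    have hmem : ∀ l : Fin m, MemLp (fun x : Fin m → X => f (x l)) 2
        (Measure.pi fun _ : Fin m => μ) := fun l =>
      hf.comp_measurePreserving (measurePreserving_eval (fun _ : Fin m => μ) l)
    have hsum : MemLp (∑ l : Fin m, fun x : Fin m → X => f (x l)) 2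
        (Measure.pi fun _ : Fin m => μ) := memLp_finsetSum' _ fun l _ => hmem l
    have hint : ∫ x, (1 / (m : ℝ)) * (∑ l : Fin m, fun x : Fin m → X => f (x l)) x
        ∂(Measure.pi fun _ : Fin m => μ) = ∫ y, f y ∂μ := by
      simp only [Finset.sum_apply]
      rw [integral_const_mul, integral_finsetSum _ fun l _ => (hmem l).integrable one_le_two]
      simp_rw [integral_comp_eval (μ := fun _ : Fin m => μ) hf.aestronglyMeasurable]
      simp [hm']
    have hvar : Var[fun x => (1 / (m : ℝ)) * (∑ l : Fin m, fun x : Fin m → X => f (x l)) x;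
        Measure.pi fun _ : Fin m => μ] = Var[f; μ] / m := by
      rw [variance_const_mul, variance_sum_pi fun _ => hf]
      simp
      field_simp
    have := meas_ge_le_variance_div_sq (hsum.const_mul (1 / (m : ℝ))) hε
    rw [hint, hvar] at this
    simp only [Finset.sum_apply] at this
    refine this.trans_eq ?_
    rw [div_right_comm]
  have hlim : Tendsto (fun m : ℕ => ENNReal.ofReal (Var[f; μ] / ε ^ 2 / m)) atTop (𝓝 0) := by
    rw [← ENNReal.ofReal_zero]
    exact ENNReal.tendsto_ofReal (tendsto_const_div_atTop_nhds_zero_nat _)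
  exact tendsto_of_tendsto_of_tendsto_of_le_of_le' tendsto_const_nhds hlim
    (Eventually.of_forall fun _ => zero_le) ((eventually_gt_atTop 0).mono hbound)

/-- Union bound over the finitely many coordinates of the sup metric. -/
lemma tendstoInMeasure_pi {Ω ι : Type*} [MeasurableSpace Ω] {P : Measure Ω} [Fintype ι]
    {E : ι → Type*} [∀ i, PseudoEMetricSpace (E i)] {f : ℕ → Ω → ∀ i, E i} {g : Ω → ∀ i, E i}
    (h : ∀ i, TendstoInMeasure P (fun n w => f n w i) atTop (fun w => g w i)) :
    TendstoInMeasure P f atTop g := by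
  intro ε hε
  have hle : ∀ n, P {w | ε ≤ edist (f n w) (g w)} ≤
      ∑ i, P {w | ε ≤ edist (f n w i) (g w i)} := by
    intro n
    refine (measure_mono fun w hw => ?_).trans (measure_iUnion_fintype_le _ _)
    by_contra hcon
    simp only [Set.mem_iUnion, Set.mem_ofPred_eq, not_exists, not_le] at hcon
    have hlt : edist (f n w) (g w) < ε := (Finset.sup_lt_iff hε).2 fun i _ => hcon i
    exact absurd hw (not_le.2 hlt)
  have hlim : Tendsto (fun n => ∑ i, P {w | ε ≤ edist (f n w i) (g w i)}) atTop (𝓝 0) := by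
    simpa using tendsto_finsetSum Finset.univ fun i _ => h i ε hε
  exact tendsto_of_tendsto_of_tendsto_of_le_of_le tendsto_const_nhds hlim (fun _ => zero_le) hle

end WeakLaw

/-! ### Convergence of the linearised kernel -/

section KernelLimit

lemma integral_coord_mul_coord {ι : Type*} [Fintype ι] [DecidableEq ι] (c c' : ι) :
    ∫ u : ι → ℝ, u c * u c' ∂(Measure.pi fun _ => gaussianReal 0 1) = if c = c' then 1 else 0 := by
  split_ifs with h
  · subst h
    rw [integral_comp_eval (μ := fun _ : ι => gaussianReal 0 1) (f := fun x : ℝ => x * x)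
      (by fun_prop)]
    have h1 := variance_of_integral_eq_zero (μ := gaussianReal 0 1) (X := id) aemeasurable_id
      (by simp)
    rw [variance_id_gaussianReal] at h1
    simpa [pow_two] using h1.symm
  · have hind : IndepFun (fun u : ι → ℝ => u c) (fun u : ι → ℝ => u c')
        (Measure.pi fun _ => gaussianReal 0 1) :=
      (iIndepFun_pi (μ := fun _ : ι => gaussianReal 0 1) (X := fun _ => id)
        (fun _ => aemeasurable_id)).indepFun h
    rw [hind.integral_fun_mul_eq_mul_integral
        (measurable_pi_apply c).aestronglyMeasurable (measurable_pi_apply c').aestronglyMeasurable,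
      integral_comp_eval (μ := fun _ : ι => gaussianReal 0 1) (f := fun x : ℝ => x) (by fun_prop)]
    simp

variable {d k dout : ℕ}

lemma deriv_feature_eq {σ : ℝ → ℝ} (hσ : ContDiff ℝ ∞ σ) (x : Fin d → ℝ) (α : MultiIdx d k)
    (v : (Fin d → ℝ) × ℝ) :
    deriv (fun b => feature σ x α v.1 b) v.2 =
      fderiv ℝ (fun v : (Fin d → ℝ) × ℝ => feature σ x α v.1 v.2) v (0, 1) :=
  (fderiv_prodMk_right ((contDiff_feature hσ x α).differentiable (by simp)) v.1 v.2).symm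

lemma partialDeriv_feature_eq {σ : ℝ → ℝ} (hσ : ContDiff ℝ ∞ σ) (x : Fin d → ℝ) (α : MultiIdx d k)
    (p : Fin d) (v : (Fin d → ℝ) × ℝ) :
    partialDeriv p (fun w => feature σ x α w v.2) v.1 =
      fderiv ℝ (fun v : (Fin d → ℝ) × ℝ => feature σ x α v.1 v.2) v (Pi.single p 1, 0) :=
  (fderiv_prodMk_left ((contDiff_feature hσ x α).differentiable (by simp)) v.1 v.2 p).symm

lemma continuous_gradProd {σ : ℝ → ℝ} (hσ : ContDiff ℝ ∞ σ) (x y : Fin d → ℝ)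
    (α β : MultiIdx d k) : Continuous (gradProd σ x y α β) := by
  unfold gradProd
  simp only [deriv_feature_eq hσ, partialDeriv_feature_eq hσ]
  exact ((continuous_fderiv_feature hσ x α _).mul (continuous_fderiv_feature hσ y β _)).add
    (continuous_finsetSum _ fun p _ =>
      (continuous_fderiv_feature hσ x α _).mul (continuous_fderiv_feature hσ y β _))

lemma polyGrowth_gradProd {σ : ℝ → ℝ} (hσ : ContDiff ℝ ∞ σ) (hb : BoundedDerivs k σ)
    (x y : Fin d → ℝ) (α β : MultiIdx d k) : PolyGrowth (gradProd σ x y α β) := by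
  unfold gradProd
  simp only [deriv_feature_eq hσ, partialDeriv_feature_eq hσ]
  exact ((polyGrowth_fderiv_feature hσ hb x α _).mul (polyGrowth_fderiv_feature hσ hb y β _)).add
    (PolyGrowth.sum fun p _ =>
      (polyGrowth_fderiv_feature hσ hb x α _).mul (polyGrowth_fderiv_feature hσ hb y β _))

lemma integrable_of_polyGrowth {f : (Fin d → ℝ) × ℝ → ℝ} (hf : PolyGrowth f) (hc : Continuous f) :
    Integrable f (neuronLaw d) :=
  memLp_one_iff_integrable.1 (hf.memLp hc _ 1 (by simp))

lemma integral_gradProd {σ : ℝ → ℝ} (hσ : ContDiff ℝ ∞ σ) (hb : BoundedDerivs k σ)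
    (x y : Fin d → ℝ) (α β : MultiIdx d k) :
    ∫ v, gradProd σ x y α β v ∂neuronLaw d =
      (∫ v, deriv (fun b => feature σ x α v.1 b) v.2 *
          deriv (fun b => feature σ y β v.1 b) v.2 ∂neuronLaw d) +
        ∑ p, ∫ v, partialDeriv p (fun w => feature σ x α w v.2) v.1 *
            partialDeriv p (fun w => feature σ y β w v.2) v.1 ∂neuronLaw d := by
  unfold gradProd
  simp only [deriv_feature_eq hσ, partialDeriv_feature_eq hσ]
  have hi : ∀ u, Integrable (fun v => fderiv ℝ (fun v : (Fin d → ℝ) × ℝ => feature σ x α v.1 v.2) v u *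
      fderiv ℝ (fun v : (Fin d → ℝ) × ℝ => feature σ y β v.1 v.2) v u) (neuronLaw d) := fun u =>
    integrable_of_polyGrowth
      ((polyGrowth_fderiv_feature hσ hb x α _).mul (polyGrowth_fderiv_feature hσ hb y β _))
      ((continuous_fderiv_feature hσ x α _).mul (continuous_fderiv_feature hσ y β _))
  rw [integral_add (hi _) (integrable_finsetSum _ fun p _ => hi _),
    integral_finsetSum _ fun p _ => hi _]

lemma continuous_feature {σ : ℝ → ℝ} (hσ : ContDiff ℝ ∞ σ) (x : Fin d → ℝ) (α : MultiIdx d k) :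
    Continuous (fun v : (Fin d → ℝ) × ℝ => feature σ x α v.1 v.2) :=
  (contDiff_feature hσ x α).continuous

lemma continuous_neuronKernel {σ : ℝ → ℝ} (hσ : ContDiff ℝ ∞ σ) (x y : Fin d → ℝ)
    (e f : Comp d dout k) : Continuous (neuronKernel σ x y e f) := by
  have h1 := (continuous_gradProd hσ x y e.1 f.1).comp
    (continuous_fst : Continuous (Prod.fst : NeuronParam d dout → _))
  have h2 := ((continuous_feature hσ x e.1).mul (continuous_feature hσ y f.1)).comp
    (continuous_fst : Continuous (Prod.fst : NeuronParam d dout → _))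
  unfold neuronKernel
  refine Continuous.add (Continuous.mul (by fun_prop) h1) ?_
  split_ifs
  · exact h2
  · exact continuous_const

lemma polyGrowth_neuronKernel {σ : ℝ → ℝ} (hσ : ContDiff ℝ ∞ σ) (hb : BoundedDerivs k σ)
    (x y : Fin d → ℝ) (e f : Comp d dout k) : PolyGrowth (neuronKernel σ x y e f) := by
  have hu : ∀ c : Fin dout, PolyGrowth (fun η : NeuronParam d dout => η.2 c) := fun c =>
    polyGrowth_clm ((ContinuousLinearMap.proj c).comp
      (ContinuousLinearMap.snd ℝ ((Fin d → ℝ) × ℝ) (Fin dout → ℝ)))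
  have h1 := (polyGrowth_gradProd hσ hb x y e.1 f.1).comp_clm
    (ContinuousLinearMap.fst ℝ ((Fin d → ℝ) × ℝ) (Fin dout → ℝ))
  have h2 := ((polyGrowth_feature hσ hb x e.1).mul (polyGrowth_feature hσ hb y f.1)).comp_clm
    (ContinuousLinearMap.fst ℝ ((Fin d → ℝ) × ℝ) (Fin dout → ℝ))
  unfold neuronKernel
  refine (((hu _).mul (hu _)).mul h1).add ?_
  split_ifs
  · exact h2
  · exact polyGrowth_const 0

lemma polyGrowth_eval {ι : Type*} [Fintype ι] (c : ι) : PolyGrowth (fun u : ι → ℝ => u c) :=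
  polyGrowth_clm (ContinuousLinearMap.proj (R := ℝ) (φ := fun _ : ι => ℝ) c)

/-- The outer weights are independent of `(w, b)` and satisfy `E[u_c u_c'] = δ_{cc'}`, which turns
the neuron average into the limiting kernel. -/
lemma phiKernel_eq {σ : ℝ → ℝ} (hσ : ContDiff ℝ ∞ σ) (hb : BoundedDerivs k σ)
    (x y : Fin d → ℝ) (e f : Comp d dout k) :
    phiKernel σ x y e f = ∫ η, neuronKernel σ x y e f η ∂unitLaw d dout +
      if e.2 = f.2 then zeroInd e.1 * zeroInd f.1 else 0 := by
  have hg := integrable_of_polyGrowth (polyGrowth_gradProd hσ hb x y e.1 f.1)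
    (continuous_gradProd hσ x y e.1 f.1)
  have hf := integrable_of_polyGrowth
    ((polyGrowth_feature hσ hb x e.1).mul (polyGrowth_feature hσ hb y f.1))
    ((continuous_feature hσ x e.1).mul (continuous_feature hσ y f.1))
  have hu : Integrable (fun u : Fin dout → ℝ => u e.2 * u f.2)
      (Measure.pi fun _ => gaussianReal 0 1) :=
    memLp_one_iff_integrable.1 (PolyGrowth.memLp (f := fun u : Fin dout → ℝ => u e.2 * u f.2)
      ((polyGrowth_eval e.2).mul (polyGrowth_eval f.2))
      (by fun_prop) _ 1 (by simp))
  have h1 : ∫ η : NeuronParam d dout, η.2 e.2 * η.2 f.2 * gradProd σ x y e.1 f.1 η.1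
      ∂unitLaw d dout = (if e.2 = f.2 then 1 else 0) * ∫ v, gradProd σ x y e.1 f.1 v ∂neuronLaw d := by
    rw [← integral_coord_mul_coord, mul_comm, ← integral_prod_mul]
    simp only [mul_comm]
  have h2 : ∫ η : NeuronParam d dout, (if e.2 = f.2 then
      feature σ x e.1 η.1.1 η.1.2 * feature σ y f.1 η.1.1 η.1.2 else 0) ∂unitLaw d dout =
      if e.2 = f.2 then ∫ v, feature σ x e.1 v.1 v.2 * feature σ y f.1 v.1 v.2 ∂neuronLaw d
        else 0 := by
    split_ifs
    · exact integral_fun_fst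
        (f := fun v : (Fin d → ℝ) × ℝ => feature σ x e.1 v.1 v.2 * feature σ y f.1 v.1 v.2)
        |>.trans (by simp)
    · simp
  have hi1 : Integrable (fun η : NeuronParam d dout =>
      η.2 e.2 * η.2 f.2 * gradProd σ x y e.1 f.1 η.1) (unitLaw d dout) := by
    simpa only [mul_comm] using hg.mul_prod hu
  have hi2 : Integrable (fun η : NeuronParam d dout => if e.2 = f.2 then
      feature σ x e.1 η.1.1 η.1.2 * feature σ y f.1 η.1.1 η.1.2 else 0) (unitLaw d dout) := by
    split_ifs
    · exact hf.comp_fst _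
    · simp
  unfold neuronKernel
  rw [integral_add hi1 hi2, h1, h2, phiKernel, phiCov, ← integral_gradProd hσ hb, zeroInd, zeroInd]
  split_ifs <;> simp_all <;> ring

variable {din Nb Nr : ℕ}

lemma continuous_linNtk {σ : ℝ → ℝ} (hσ : ContDiff ℝ ∞ σ) (xb : Fin Nb → Fin din → ℝ)
    (xr : Fin Nr → Fin din → ℝ) (m : ℕ) :
    Continuous (fun (θ : Param din dout m) (r q : LinRow din dout k Nb Nr) =>
      linNtk σ xb xr θ r q) := by
  refine continuous_pi fun r => continuous_pi fun q => ?_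
  simp only [linNtk_apply hσ]
  refine Continuous.add (continuous_const.mul (continuous_finsetSum _ fun l _ => ?_))
    continuous_const
  refine (continuous_neuronKernel hσ _ _ _ _).comp ((neuron l).continuous.prodMk ?_)
  exact continuous_pi fun c => continuous_apply _

theorem tendstoInMeasure_linNtk {σ : ℝ → ℝ} (hσ : ContDiff ℝ ∞ σ) (hb : BoundedDerivs k σ)
    (xb : Fin Nb → Fin din → ℝ) (xr : Fin Nr → Fin din → ℝ)
    {Ω : Type*} [MeasurableSpace Ω] (P : Measure Ω)
    (θ : ∀ m : ℕ, Ω → Param din dout m) (hθ : ∀ m, HasLaw (θ m) (gaussianInit din dout m) P) :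
    TendstoInMeasure P
      (fun m w (p q : LinRow din dout k Nb Nr) => linNtk σ xb xr (θ m w) p q) atTop
      (fun _ p q => limitLinNtk σ xb xr p q) := by
  refine tendstoInMeasure_pi fun r => tendstoInMeasure_pi fun q => ?_
  rw [tendstoInMeasure_iff_dist]
  intro ε hε
  set f := neuronKernel σ (LinRow.point xb xr r) (LinRow.point xb xr q) (LinRow.comp r)
    (LinRow.comp q) with hf
  have hfc : Continuous f := continuous_neuronKernel hσ _ _ _ _
  have hlaw : ∀ m, HasLaw (fun w => (splitParam (θ m w)).1)
      (Measure.pi fun _ : Fin m => unitLaw din dout) P := fun m =>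
    (measurePreserving_fst.comp measurePreserving_splitParam).hasLaw.fun_comp (hθ m)
  have hmeas : ∀ m : ℕ, MeasurableSet {x : Fin m → NeuronParam din dout |
      ε ≤ |1 / (m : ℝ) * ∑ l, f (x l) - ∫ y, f y ∂unitLaw din dout|} := by
    intro m
    have : Measurable fun x : Fin m → NeuronParam din dout =>
        |1 / (m : ℝ) * ∑ l, f (x l) - ∫ y, f y ∂unitLaw din dout| := by
      have hfm := hfc.measurable
      fun_prop
    exact measurableSet_le measurable_const this
  have hlim := tendsto_measure_average_sub_integral (unitLaw din dout)
    ((polyGrowth_neuronKernel hσ hb (LinRow.point xb xr r) (LinRow.point xb xr q) (LinRow.comp r)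
      (LinRow.comp q)).memLp hfc _ 2 (by simp)) hε
  -- The bias constants cancel in the difference, and the event depends on `θ m` only through its
  -- i.i.d. neurons.
  refine hlim.congr fun m => ?_
  rw [← (hlaw m).measure_eq (hmeas m)]
  congr 1
  ext w
  simp only [Set.mem_ofPred_eq, linNtk_apply hσ, limitLinNtk, Matrix.of_apply, phiKernel_eq hσ hb,
    Real.dist_eq, add_sub_add_right_eq_sub]
  rfl

end KernelLimit

/-! ### Quadratic forms of the limiting covariance -/

section QuadForm

variable {d k dout : ℕ} {ι : Type*} [Fintype ι]

/-- A linear combination of the contributions of one hidden neuron to several outputs. -/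
def neuronSum (t : ι → ℝ) (c : ι → Fin dout) (F : ι → (Fin d → ℝ) × ℝ → ℝ)
    (η : NeuronParam d dout) : ℝ := ∑ i, t i * (η.2 (c i) * F i η.1)

variable (t : ι → ℝ) (c : ι → Fin dout) {F : ι → (Fin d → ℝ) × ℝ → ℝ}

lemma continuous_neuronSum (hc : ∀ i, Continuous (F i)) : Continuous (neuronSum t c F) := by
  unfold neuronSum
  refine continuous_finsetSum _ fun i _ => continuous_const.mul (Continuous.mul (by fun_prop) ?_)
  exact (hc i).comp continuous_fst

lemma polyGrowth_neuronSum (hF : ∀ i, PolyGrowth (F i)) : PolyGrowth (neuronSum t c F) := by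
  refine PolyGrowth.sum fun i _ => (polyGrowth_const _).mul (PolyGrowth.mul ?_ ?_)
  · exact (polyGrowth_eval (c i)).comp_clm
      (ContinuousLinearMap.snd ℝ ((Fin d → ℝ) × ℝ) (Fin dout → ℝ))
  · exact (hF i).comp_clm (ContinuousLinearMap.fst ℝ ((Fin d → ℝ) × ℝ) (Fin dout → ℝ))

lemma integral_neuronSum (hc : ∀ i, Continuous (F i)) (hF : ∀ i, PolyGrowth (F i)) :
    ∫ η, neuronSum t c F η ∂unitLaw d dout = 0 := by
  unfold neuronSum
  rw [integral_finsetSum]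
  · refine Finset.sum_eq_zero fun i _ => ?_
    have : ∫ η : NeuronParam d dout, F i η.1 * η.2 (c i) ∂unitLaw d dout = 0 := by
      rw [integral_prod_mul (f := F i) (g := fun u : Fin dout → ℝ => u (c i)),
        integral_comp_eval (μ := fun _ : Fin dout => gaussianReal 0 1) (f := fun x : ℝ => x)
          (by fun_prop)]
      simp
    rw [integral_const_mul]
    simp only [mul_comm] at this ⊢
    rw [this, mul_zero]
  · intro i _
    -- A single summand is a `neuronSum` over `Unit`, hence integrable.
    have h1 := (continuous_neuronSum (F := fun _ : Unit => F i) (fun _ => t i) (fun _ => c i)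
      fun _ => hc i)
    have h2 := (polyGrowth_neuronSum (F := fun _ : Unit => F i) (fun _ => t i) (fun _ => c i)
      fun _ => hF i)
    have h3 := memLp_one_iff_integrable.1 (h2.memLp h1 (unitLaw d dout) 1 (by simp))
    unfold neuronSum at h3
    simpa using h3

/-- Orthonormality of the outer weights kills the cross terms. With features it represents the
quadratic form of the covariance, with their derivatives that of the gradient part of `κ`. -/
lemma integral_neuronSum_sq (hc : ∀ i, Continuous (F i)) (hF : ∀ i, PolyGrowth (F i)) :
    ∫ η, neuronSum t c F η ^ 2 ∂unitLaw d dout =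
      ∑ i, ∑ j, t i * t j * (if c i = c j then ∫ v, F i v * F j v ∂neuronLaw d else 0) := by
  have hprod : ∀ i j, Integrable (fun η : NeuronParam d dout =>
      (F i η.1 * F j η.1) * (η.2 (c i) * η.2 (c j))) (unitLaw d dout) := by
    intro i j
    refine Integrable.mul_prod (f := fun v => F i v * F j v)
      (g := fun u : Fin dout → ℝ => u (c i) * u (c j)) ?_ ?_
    · exact integrable_of_polyGrowth ((hF i).mul (hF j)) ((hc i).mul (hc j))
    · exact memLp_one_iff_integrable.1
        (((polyGrowth_eval (c i)).mul (polyGrowth_eval (c j))).memLp (by fun_prop) _ 1 (by simp))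
  have hexp : ∀ η : NeuronParam d dout, neuronSum t c F η ^ 2 =
      ∑ i, ∑ j, t i * t j * ((F i η.1 * F j η.1) * (η.2 (c i) * η.2 (c j))) := by
    intro η
    rw [pow_two, neuronSum, Finset.sum_mul_sum]
    exact Finset.sum_congr rfl fun i _ => Finset.sum_congr rfl fun j _ => by ring
  simp only [hexp]
  rw [integral_finsetSum _ fun i _ => integrable_finsetSum _ fun j _ => (hprod i j).const_mul _]
  refine Finset.sum_congr rfl fun i _ => ?_
  rw [integral_finsetSum _ fun j _ => (hprod i j).const_mul _]
  refine Finset.sum_congr rfl fun j _ => ?_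
  rw [integral_const_mul, integral_prod_mul (f := fun v => F i v * F j v)
    (g := fun u : Fin dout → ℝ => u (c i) * u (c j)), integral_coord_mul_coord]
  split_ifs <;> simp

/-- The left side is the variance contributed by the outer biases, grouped by output coordinate. -/
lemma sum_sq_fiber (z : ι → ℝ) :
    ∑ a, (∑ i, if c i = a then t i * z i else 0) ^ 2 =
      ∑ i, ∑ j, t i * t j * (if c i = c j then z i * z j else 0) := by
  simp only [pow_two, Finset.sum_mul_sum]
  rw [Finset.sum_comm]
  refine Finset.sum_congr rfl fun i _ => ?_
  rw [Finset.sum_comm]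
  refine Finset.sum_congr rfl fun j _ => ?_
  rw [Finset.sum_eq_single (c i)]
  · by_cases h : c i = c j
    · simp only [h, if_true]
      ring
    · simp [h, Ne.symm h]
  · intro a _ ha
    rw [if_neg ha.symm, zero_mul]
  · exact fun h => absurd (Finset.mem_univ _) h

lemma phiCov_eq (σ : ℝ → ℝ) (x y : Fin d → ℝ) (e f : Comp d dout k) :
    phiCov σ x y e f =
      (if e.2 = f.2 then ∫ v, feature σ x e.1 v.1 v.2 * feature σ y f.1 v.1 v.2 ∂neuronLaw d
        else 0) + if e.2 = f.2 then zeroInd e.1 * zeroInd f.1 else 0 := by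
  rw [phiCov, zeroInd, zeroInd]
  split_ifs <;> simp_all

/-- The quadratic form of the limiting covariance as a sum of squares. -/
lemma sum_mul_phiCov {σ : ℝ → ℝ} (hσ : ContDiff ℝ ∞ σ) (hb : BoundedDerivs k σ)
    (x : ι → Fin d → ℝ) (e : ι → Comp d dout k) :
    ∑ i, ∑ j, t i * t j * phiCov σ (x i) (x j) (e i) (e j) =
      ∫ η, neuronSum t (fun i => (e i).2)
          (fun i v => feature σ (x i) (e i).1 v.1 v.2) η ^ 2 ∂unitLaw d dout +
        ∑ a, (∑ i, if (e i).2 = a then t i * zeroInd (e i).1 else 0) ^ 2 := by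
  rw [integral_neuronSum_sq _ _ (fun i => continuous_feature hσ _ _)
    (fun i => polyGrowth_feature hσ hb _ _), sum_sq_fiber]
  simp only [phiCov_eq, mul_add, Finset.sum_add_distrib]

lemma dotProduct_mulVec_eq_sum (S : Matrix ι ι ℝ) (t : ι → ℝ) :
    t ⬝ᵥ S *ᵥ t = ∑ i, ∑ j, t i * t j * S i j := by
  simp only [dotProduct, mulVec, Finset.mul_sum]
  exact Finset.sum_congr rfl fun i _ => Finset.sum_congr rfl fun j _ => by ring

lemma phiCov_comm (σ : ℝ → ℝ) (x y : Fin d → ℝ) (e f : Comp d dout k) :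
    phiCov σ x y e f = phiCov σ y x f e := by
  rw [phiCov_eq, phiCov_eq]
  simp only [mul_comm, eq_comm (a := e.2)]

lemma posSemidef_phiCov {σ : ℝ → ℝ} (hσ : ContDiff ℝ ∞ σ) (hb : BoundedDerivs k σ)
    (x : ι → Fin d → ℝ) (e : ι → Comp d dout k) :
    (Matrix.of fun i j => phiCov σ (x i) (x j) (e i) (e j)).PosSemidef := by
  refine .of_dotProduct_mulVec_nonneg ?_ fun t => ?_
  · ext i j
    exact phiCov_comm _ _ _ _ _
  · rw [star_trivial, dotProduct_mulVec_eq_sum]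
    simp only [Matrix.of_apply]
    rw [sum_mul_phiCov t hσ hb x e]
    exact add_nonneg (integral_nonneg fun _ => sq_nonneg _)
      (Finset.sum_nonneg fun _ _ => sq_nonneg _)

end QuadForm

/-! ### Convergence of the network derivatives to the Gaussian process -/

section CLT

open Complex in
-- Central limit theorem for arbitrary variance `v`: normalise to variance one and evaluate at `√v`.
-- If `v = 0` then `X` vanishes almost everywhere.
lemma tendsto_charFun_inv_sqrt_pow {Ω : Type*} [MeasurableSpace Ω] {P : Measure Ω}
    [IsProbabilityMeasure P] {X : Ω → ℝ} (hX : MemLp X 2 P) (h0 : P[X] = 0) :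
    Tendsto (fun n : ℕ => (charFun (P.map X) (√n)⁻¹) ^ n) atTop
      (𝓝 (exp (-(∫ w, X w ^ 2 ∂P : ℝ) / 2))) := by
  have hXm : AEMeasurable X P := hX.aestronglyMeasurable.aemeasurable
  rcases (integral_nonneg fun w => sq_nonneg (X w) : 0 ≤ ∫ w, X w ^ 2 ∂P).eq_or_lt with hv | hv
  · have hX0 : X =ᵐ[P] fun _ => 0 := by
      have := (integral_eq_zero_iff_of_nonneg (fun w => sq_nonneg (X w)) hX.integrable_sq).1 hv.symm
      filter_upwards [this] with w hw
      exact pow_eq_zero_iff two_ne_zero |>.1 hw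
    rw [← hv, Measure.map_congr hX0]
    simp [charFun_apply]
  · set v := ∫ w, X w ^ 2 ∂P with hvdef
    have hs : √v ≠ 0 := (Real.sqrt_pos.2 hv).ne'
    have h1 := tendsto_charFun_inv_sqrt_mul_pow (P := P) (X := fun w => (√v)⁻¹ * X w)
      (hXm.const_mul _) (by rw [integral_const_mul, h0, mul_zero])
      (by
        simp only [Pi.pow_apply, mul_pow]
        rw [integral_const_mul, ← hvdef, inv_pow, Real.sq_sqrt hv.le, inv_mul_cancel₀ hv.ne']) (√v)
    have h2 : ((√v : ℝ) : ℂ) ^ 2 = (v : ℂ) := by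
      rw [← ofReal_pow, Real.sq_sqrt hv.le]
    rw [h2] at h1
    refine h1.congr fun n => ?_
    rw [charFun_map_mul_comp hXm]
    congr 2
    field_simp

variable {din dout k Nr m : ℕ}

lemma phiVec_eq {σ : ℝ → ℝ} (hσ : ContDiff ℝ ∞ σ) (xr : Fin Nr → Fin din → ℝ)
    (θ : Param din dout m) (i : Fin Nr × Comp din dout k) :
    phiVec σ xr k θ i = (√(m : ℝ))⁻¹ * ∑ l, ((splitParam θ).1 l).2 i.2.2 *
        feature σ (xr i.1) i.2.1 ((splitParam θ).1 l).1.1 ((splitParam θ).1 l).1.2 +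
      zeroInd i.2.1 * (splitParam θ).2 i.2.2 := by
  rw [phiVec, Phi_network hσ, zeroInd, one_div]
  simp [splitParam, neuron_apply]

lemma continuous_phiVec {σ : ℝ → ℝ} (hσ : ContDiff ℝ ∞ σ) (xr : Fin Nr → Fin din → ℝ) :
    Continuous (phiVec σ xr k : Param din dout m → _) := by
  refine continuous_pi fun i => ?_
  have : Continuous (fun θ : Param din dout m => linOutputs (Nb := 0) (k := k) σ
      (fun i => i.elim0) xr θ (Sum.inr i)) :=
    (differentiable_linOutputs hσ _ _ _).continuous
  exact this

open Complex in
lemma integral_exp_sum_gaussian {ι : Type*} [Fintype ι] (s : ι → ℝ) :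
    ∫ b : ι → ℝ, exp ((∑ a, s a * b a : ℝ) * I) ∂(Measure.pi fun _ => gaussianReal 0 1) =
      exp (-(∑ a, s a ^ 2 : ℝ) / 2) := by
  simp_rw [ofReal_sum, Finset.sum_mul, exp_sum, ofReal_mul]
  rw [integral_fintype_prod_eq_prod (f := fun a (x : ℝ) => exp ((s a : ℂ) * (x : ℂ) * I))]
  simp_rw [← charFun_apply_real, charFun_gaussianReal]
  rw [← exp_sum]
  congr 1
  simp [Finset.sum_div, neg_div]

open Complex in
-- Independence factorises the characteristic function: the `m` identically distributed neurons give
-- a power, and the outer bias gives an exactly Gaussian factor.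
lemma charFun_map_phiVec {σ : ℝ → ℝ} (hσ : ContDiff ℝ ∞ σ) (xr : Fin Nr → Fin din → ℝ)
    {Ω : Type*} [MeasurableSpace Ω] {P : Measure Ω}
    {θ : Ω → Param din dout m} (hθ : HasLaw θ (gaussianInit din dout m) P)
    (t : EuclideanSpace ℝ (Fin Nr × Comp din dout k)) :
    charFun (P.map fun w => WithLp.toLp 2 (phiVec σ xr k (θ w))) t =
      charFun ((unitLaw din dout).map (neuronSum (WithLp.ofLp t) (fun i => i.2.2)
        (fun i v => feature σ (xr i.1) i.2.1 v.1 v.2))) (√(m : ℝ))⁻¹ ^ m *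
      exp (-(∑ a, (∑ i : Fin Nr × Comp din dout k,
        if i.2.2 = a then t i * zeroInd i.2.1 else 0) ^ 2 : ℝ) / 2) := by
  set g := neuronSum (WithLp.ofLp t) (fun i => i.2.2)
    (fun i v => feature σ (xr i.1) i.2.1 v.1 v.2) with hg
  have hgc : Continuous g := continuous_neuronSum _ _ fun i => continuous_feature hσ _ _
  set s : Fin dout → ℝ := fun a => ∑ i : Fin Nr × Comp din dout k,
    if i.2.2 = a then t i * zeroInd i.2.1 else 0 with hs
  have hinner : ∀ θ₀ : Param din dout m,
      inner ℝ (WithLp.toLp 2 (phiVec σ xr k θ₀)) t =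
        ∑ l, (√(m : ℝ))⁻¹ * g ((splitParam θ₀).1 l) + ∑ a, s a * (splitParam θ₀).2 a := by
    intro θ₀
    simp only [PiLp.inner_apply, phiVec_eq hσ, hg, neuronSum, hs]
    simp only [RCLike.inner_apply, conj_trivial, mul_add, Finset.sum_add_distrib]
    congr 1
    · rw [← Finset.mul_sum, Finset.sum_comm, Finset.mul_sum]
      refine Finset.sum_congr rfl fun i _ => ?_
      simp only [Finset.mul_sum]
      exact Finset.sum_congr rfl fun l _ => by ring
    · simp only [Finset.sum_mul, ite_mul, zero_mul]
      rw [Finset.sum_comm]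
      refine Finset.sum_congr rfl fun i _ => ?_
      rw [Finset.sum_ite_eq, if_pos (Finset.mem_univ _)]
      ring
  have hlaw := measurePreserving_splitParam.hasLaw.fun_comp hθ
  have hphi : AEMeasurable (fun w => WithLp.toLp 2 (phiVec σ xr k (θ w))) P := by
    have h1 : Continuous fun θ₀ : Param din dout m => WithLp.toLp 2 (phiVec σ xr k θ₀) :=
      (PiLp.continuous_toLp 2 _).comp (continuous_phiVec hσ xr)
    exact h1.measurable.comp_aemeasurable hθ.aemeasurable
  rw [charFun_apply, integral_map hphi (by fun_prop)]
  simp only [hinner]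
  have hstep : ∫ w, exp ((∑ l, (√(m : ℝ))⁻¹ * g ((splitParam (θ w)).1 l) +
      ∑ a, s a * (splitParam (θ w)).2 a : ℝ) * I) ∂P =
      ∫ η : (Fin m → NeuronParam din dout) × (Fin dout → ℝ),
        exp ((∑ l, (√(m : ℝ))⁻¹ * g (η.1 l) + ∑ a, s a * η.2 a : ℝ) * I)
        ∂((Measure.pi fun _ : Fin m => unitLaw din dout).prod
          (Measure.pi fun _ : Fin dout => gaussianReal 0 1)) := by
    rw [← hlaw.map_eq, integral_map hlaw.aemeasurable]
    exact Continuous.aestronglyMeasurable (by fun_prop)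
  rw [hstep]
  simp only [ofReal_add, add_mul, exp_add]
  rw [integral_prod_mul (f := fun η : Fin m → NeuronParam din dout =>
    exp ((∑ l, (√(m : ℝ))⁻¹ * g (η l) : ℝ) * I))
    (g := fun b : Fin dout → ℝ => exp ((∑ a, s a * b a : ℝ) * I)), integral_exp_sum_gaussian]
  congr 1
  simp_rw [ofReal_sum, Finset.sum_mul, exp_sum]
  rw [integral_fintype_prod_eq_pow (f := fun η => exp (((√(m : ℝ))⁻¹ * g η : ℝ) * I)),
    Fintype.card_fin, charFun_apply_real, integral_map hgc.aemeasurable (by fun_prop)]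
  simp only [ofReal_mul]

/-- By Lévy's continuity theorem it suffices to treat characteristic functions; by `sum_mul_phiCov`
the neuron and bias exponents add up to that of the Gaussian limit. -/
theorem tendstoInDistribution_phiVec {σ : ℝ → ℝ} (hσ : ContDiff ℝ ∞ σ) (hb : BoundedDerivs k σ)
    (xr : Fin Nr → Fin din → ℝ)
    {Ω : Type*} [MeasurableSpace Ω] (P : Measure Ω) [IsProbabilityMeasure P]
    (θ : ∀ m : ℕ, Ω → Param din dout m) (hθ : ∀ m, HasLaw (θ m) (gaussianInit din dout m) P) :
    TendstoInDistribution (fun m w => phiVec σ xr k (θ m w)) atTop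
      (fun G => WithLp.ofLp G) (fun _ => P) (limitPhiLaw σ xr dout k) := by
  have hphi : ∀ m, AEMeasurable (fun w => WithLp.toLp 2 (phiVec σ xr k (θ m w))) P := by
    intro m
    have h1 : Continuous fun θ₀ : Param din dout m => WithLp.toLp 2 (phiVec σ xr k θ₀) :=
      (PiLp.continuous_toLp 2 _).comp (continuous_phiVec hσ xr)
    exact h1.measurable.comp_aemeasurable (hθ m).aemeasurable
  have h : TendstoInDistribution (fun m w => WithLp.toLp 2 (phiVec σ xr k (θ m w))) atTop
      (fun G => G) (fun _ => P) (limitPhiLaw σ xr dout k) := by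
    refine ⟨hphi, aemeasurable_id, ?_⟩
    refine ProbabilityMeasure.tendsto_iff_tendsto_charFun.2 fun t => ?_
    simp only [ProbabilityMeasure.coe_mk, Measure.map_id']
    rw [charFun_multivariateGaussian (posSemidef_phiCov hσ hb
      (fun i : Fin Nr × Comp din dout k => xr i.1) (fun i => i.2)), dotProduct_mulVec_eq_sum]
    simp only [Matrix.of_apply]
    rw [sum_mul_phiCov _ hσ hb (fun i : Fin Nr × Comp din dout k => xr i.1) (fun i => i.2)]
    simp only [charFun_map_phiVec hσ xr (hθ _)]
    have hc : ∀ i : Fin Nr × Comp din dout k, Continuous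
      (fun v : (Fin din → ℝ) × ℝ => feature σ (xr i.1) i.2.1 v.1 v.2) :=
      fun i => continuous_feature hσ _ _
    have hF : ∀ i : Fin Nr × Comp din dout k, PolyGrowth
      (fun v : (Fin din → ℝ) × ℝ => feature σ (xr i.1) i.2.1 v.1 v.2) :=
      fun i => polyGrowth_feature hσ hb _ _
    have hlim := tendsto_charFun_inv_sqrt_pow (P := unitLaw din dout)
      ((polyGrowth_neuronSum (WithLp.ofLp t) (fun i => i.2.2) hF).memLp
        (continuous_neuronSum _ _ hc) _ 2 (by simp))
      (integral_neuronSum _ _ hc hF)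
    refine (hlim.mul_const _).congr' (Eventually.of_forall fun m => rfl) |>.trans_eq ?_
    rw [← Complex.exp_add]
    congr 2
    simp only [inner_zero_right, Complex.ofReal_zero, zero_mul, zero_sub, Complex.ofReal_add]
    ring
  exact h.continuous_comp (PiLp.continuous_ofLp 2 _)

end CLT

/-! ### Convergence of the nonlinear factor and of the full kernel -/

section FullKernel

variable {din dout k Nb Nr : ℕ}

lemma continuous_partialDeriv {ι : Type} [Fintype ι] [DecidableEq ι] {R : (ι → ℝ) → ℝ}
    (hR : ContDiff ℝ 1 R) (i : ι) : Continuous (partialDeriv i R) :=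
  (hR.continuous_fderiv (by simp)).clm_apply continuous_const

lemma continuous_lambdaR {R : (Comp din dout k → ℝ) → ℝ} (hR : ContDiff ℝ 1 R) :
    Continuous fun (z : Fin Nr × Comp din dout k → ℝ) (p : Row dout Nb Nr)
      (q : LinRow din dout k Nb Nr) => lambdaR R Nb z p q := by
  refine continuous_pi fun p => continuous_pi fun q => ?_
  rcases p with p | i <;> rcases q with q | ⟨j, e⟩
  · exact continuous_const
  · exact continuous_const
  · exact continuous_const
  · simp only [lambdaR, Matrix.fromBlocks_apply₂₂, Matrix.of_apply]
    split_ifs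
    · exact (continuous_partialDeriv hR e).comp (by fun_prop)
    · exact continuous_const

variable {σ : ℝ → ℝ} (xb : Fin Nb → Fin din → ℝ) (xr : Fin Nr → Fin din → ℝ)
  {R : (Comp din dout k → ℝ) → ℝ} {Ω : Type*} [MeasurableSpace Ω] (P : Measure Ω)
  [IsProbabilityMeasure P] (θ : ∀ m : ℕ, Ω → Param din dout m)

theorem tendstoInDistribution_lambdaR (hσ : ContDiff ℝ ∞ σ) (hb : BoundedDerivs k σ)
    (hR : ContDiff ℝ 1 R) (hθ : ∀ m, HasLaw (θ m) (gaussianInit din dout m) P) :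
    TendstoInDistribution
      (fun m w (p : Row dout Nb Nr) (q : LinRow din dout k Nb Nr) =>
        lambdaR R Nb (phiVec σ xr k (θ m w)) p q) atTop
      (fun G p q => lambdaR R Nb (WithLp.ofLp G) p q)
      (fun _ => P) (limitPhiLaw σ xr dout k) :=
  (tendstoInDistribution_phiVec hσ hb xr P θ hθ).continuous_comp
    (g := fun z (p : Row dout Nb Nr) (q : LinRow din dout k Nb Nr) => lambdaR R Nb z p q)
    (continuous_lambdaR hR)

/-- Slutsky: `Φ` converges in law and `K_Φ` to a constant in probability, so the pair converges in
law, and the matrix product is continuous in it. -/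
theorem tendstoInDistribution_ntk (hσ : ContDiff ℝ ∞ σ) (hb : BoundedDerivs k σ)
    (hR : ContDiff ℝ 1 R) (hθ : ∀ m, HasLaw (θ m) (gaussianInit din dout m) P) :
    TendstoInDistribution
      (fun m w (p q : Row dout Nb Nr) => ntk σ R xb xr (θ m w) p q) atTop
      (fun G p q => limitNtk σ R xb xr (WithLp.ofLp G) p q)
      (fun _ => P) (limitPhiLaw σ xr dout k) := by
  have hg : Continuous fun (zK : (Fin Nr × Comp din dout k → ℝ) ×
      (LinRow din dout k Nb Nr → LinRow din dout k Nb Nr → ℝ)) (i j : Row dout Nb Nr) =>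
      ∑ q, (∑ r, lambdaR R Nb zK.1 i r * zK.2 r q) * lambdaR R Nb zK.1 j q := by
    have hL : ∀ i r, Continuous fun (zK : (Fin Nr × Comp din dout k → ℝ) ×
        (LinRow din dout k Nb Nr → LinRow din dout k Nb Nr → ℝ)) => lambdaR R Nb zK.1 i r :=
      fun i r => (continuous_apply_apply i r).comp ((continuous_lambdaR hR).comp continuous_fst)
    fun_prop
  have hborel : BorelSpace (LinRow din dout k Nb Nr → LinRow din dout k Nb Nr → ℝ) :=
    @Pi.borelSpace _ _ _ _ _ _ fun _ => inferInstance
  have := (tendstoInDistribution_phiVec hσ hb xr P θ hθ).continuous_comp_prodMk_of_tendstoInMeasure_const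
    hg (tendstoInMeasure_linNtk hσ hb xb xr P θ hθ)
    (fun m => (continuous_linNtk hσ xb xr m).measurable.comp_aemeasurable (hθ m).aemeasurable)
  simp only [ntk_apply hσ (hR.differentiable (by simp)), limitNtk_eq_sum]
  exact this

end FullKernel

/-! ### Nondegeneracy of the limiting covariance -/

section Nondegenerate

instance isOpenPosMeasure_gaussianReal : (gaussianReal 0 1).IsOpenPosMeasure :=
  (gaussianReal_absolutelyContinuous' 0 one_ne_zero).isOpenPosMeasure

variable {d k dout : ℕ}

/-- Ensures that continuous functions equal almost everywhere are equal. -/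
instance isOpenPosMeasure_unitLaw : (unitLaw d dout).IsOpenPosMeasure := by
  have (ι : Type) [Fintype ι] : (Measure.pi fun _ : ι => gaussianReal 0 1).IsOpenPosMeasure :=
    inferInstance
  have : (neuronLaw d).IsOpenPosMeasure := Measure.prod.instIsOpenPosMeasure
  exact Measure.prod.instIsOpenPosMeasure

lemma exists_iteratedDeriv_ne_zero {σ : ℝ → ℝ} {n j : ℕ} (hj : j ≤ n)
    (h : ∃ s, iteratedDeriv n σ s ≠ 0) : ∃ s, iteratedDeriv j σ s ≠ 0 := by
  by_contra! hcon
  obtain ⟨s, hs⟩ := h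
  apply hs
  obtain ⟨i, rfl⟩ := Nat.exists_eq_add_of_le hj
  have h0 : iteratedDeriv j σ = fun _ => 0 := funext hcon
  rw [iteratedDeriv_eq_iterate] at h0 ⊢
  rw [add_comm, Function.iterate_add_apply, h0, ← iteratedDeriv_eq_iterate]
  simp

/-- A polynomial that vanishes at every real point is zero, and distinct multi-indices give distinct
monomials. -/
lemma coeff_eq_zero_of_sum_monom (a : MultiIdx d k → ℝ)
    (h : ∀ w, ∑ α, a α * monom α w = 0) (α : MultiIdx d k) : a α = 0 := by
  set expo : MultiIdx d k → Fin d →₀ ℕ := fun α => Finsupp.equivFunOnFinite.symm fun p => (α.1 p : ℕ)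
    with hexpo
  have hinj : Function.Injective expo := by
    intro α β hαβ
    refine Subtype.ext (funext fun p => Fin.ext ?_)
    exact DFunLike.congr_fun hαβ p
  have hP : (∑ β, MvPolynomial.monomial (expo β) (a β) : MvPolynomial (Fin d) ℝ) = 0 := by
    refine MvPolynomial.funext fun w => ?_
    rw [map_sum, map_zero, ← h w]
    refine Finset.sum_congr rfl fun β _ => ?_
    rw [MvPolynomial.eval_monomial, Finsupp.prod_fintype _ _ (fun _ => pow_zero _)]
    rfl
  have hc := congrArg (MvPolynomial.coeff (expo α)) hP
  rw [MvPolynomial.coeff_sum, MvPolynomial.coeff_zero] at hc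
  simpa [MvPolynomial.coeff_monomial, hinj.eq_iff] using hc

lemma eq_zero_of_neuronSum_feature {σ : ℝ → ℝ} (hσ : ContDiff ℝ ∞ σ)
    (hne : ∃ s, iteratedDeriv k σ s ≠ 0) (x : Fin d → ℝ) (t : Comp d dout k → ℝ)
    (h : ∀ η : NeuronParam d dout, neuronSum t (fun e => e.2)
      (fun e v => feature σ x e.1 v.1 v.2) η = 0) : t = 0 := by
  funext ⟨α, c⟩
  obtain ⟨s, hs⟩ := exists_iteratedDeriv_ne_zero (order_le α) hne
  have hsum : ∀ w, ∑ β, (t (β, c) * iteratedDeriv (order β) σ s) * monom β w = 0 := by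
    intro w
    -- This bias freezes the preactivation at `s` for every `w`, leaving a polynomial in `w`; the
    -- outer weight `e_c` isolates coordinate `c`.
    rw [← h ((w, s - ∑ p, w p * x p), Pi.single c 1), neuronSum, Fintype.sum_prod_type]
    refine Finset.sum_congr rfl fun β _ => ?_
    rw [Finset.sum_eq_single c]
    · simp only [feature_eq hσ, Pi.single_eq_same, add_sub_cancel, one_mul]
      ring
    · intro c' _ hc'
      simp [Pi.single_eq_of_ne hc']
    · exact fun hc => absurd (Finset.mem_univ c) hc
  exact (mul_eq_zero.1 (coeff_eq_zero_of_sum_monom _ hsum α)).resolve_right hs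

/-- Stated at one point: collocation points may coincide, so the joint covariance can be singular. A
null vector would give a neuron sum that vanishes almost everywhere, hence identically. -/
lemma posDef_phiCov {σ : ℝ → ℝ} (hσ : ContDiff ℝ ∞ σ) (hb : BoundedDerivs k σ)
    (hne : ∃ s, iteratedDeriv k σ s ≠ 0) (x : Fin d → ℝ) :
    (Matrix.of fun e f : Comp d dout k => phiCov σ x x e f).PosDef := by
  refine .of_dotProduct_mulVec_pos ?_ fun t ht => ?_
  · ext i j
    exact phiCov_comm _ _ _ _ _
  rw [star_trivial, dotProduct_mulVec_eq_sum]
  simp only [Matrix.of_apply]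
  rw [sum_mul_phiCov t hσ hb (fun _ => x) (fun e => e)]
  refine add_pos_of_pos_of_nonneg ?_ (Finset.sum_nonneg fun _ _ => sq_nonneg _)
  refine (integral_nonneg fun _ => sq_nonneg _).lt_of_ne' fun h0 => ht ?_
  have hc := continuous_neuronSum t (fun e : Comp d dout k => e.2)
    (F := fun e v => feature σ x e.1 v.1 v.2) fun e => continuous_feature hσ _ _
  have hg := polyGrowth_neuronSum t (fun e : Comp d dout k => e.2)
    (F := fun e v => feature σ x e.1 v.1 v.2) fun e => polyGrowth_feature hσ hb _ _
  have hi := (hg.memLp hc (unitLaw d dout) 2 (by simp)).integrable_sq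
  have hae := (integral_eq_zero_iff_of_nonneg (fun _ => sq_nonneg _) hi).1 h0
  have heq := (Continuous.ae_eq_iff_eq (unitLaw d dout) (hc.pow 2) continuous_const).1 hae
  exact eq_zero_of_neuronSum_feature hσ hne x t fun η =>
    pow_eq_zero_iff two_ne_zero |>.1 (congrFun heq η)

/-- The part beyond `Σ` is a sum of Gram matrices of derivatives in `b` and `w_p`, hence positive
semidefinite. -/
lemma posDef_phiKernel {σ : ℝ → ℝ} (hσ : ContDiff ℝ ∞ σ) (hb : BoundedDerivs k σ)
    (hne : ∃ s, iteratedDeriv k σ s ≠ 0) (x : Fin d → ℝ) :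
    (Matrix.of fun e f : Comp d dout k => phiKernel σ x x e f).PosDef := by
  set A : Matrix (Comp d dout k) (Comp d dout k) ℝ := Matrix.of fun e f => if e.2 = f.2 then
      (∫ v, deriv (fun b => feature σ x e.1 v.1 b) v.2 *
          deriv (fun b => feature σ x f.1 v.1 b) v.2 ∂neuronLaw d)
        + ∑ p, ∫ v, partialDeriv p (fun w => feature σ x e.1 w v.2) v.1 *
            partialDeriv p (fun w => feature σ x f.1 w v.2) v.1 ∂neuronLaw d
    else 0 with hA
  have hAps : A.PosSemidef := by
    refine .of_dotProduct_mulVec_nonneg ?_ fun t => ?_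
    · ext e f
      simp only [hA, Matrix.conjTranspose_apply, Matrix.of_apply, star_trivial, mul_comm,
        eq_comm (a := f.2)]
    · rw [star_trivial, dotProduct_mulVec_eq_sum]
      have key : ∀ u, 0 ≤ ∑ e : Comp d dout k, ∑ f : Comp d dout k, t e * t f * (if e.2 = f.2 then
          ∫ v, fderiv ℝ (fun v : (Fin d → ℝ) × ℝ => feature σ x e.1 v.1 v.2) v u *
            fderiv ℝ (fun v : (Fin d → ℝ) × ℝ => feature σ x f.1 v.1 v.2) v u ∂neuronLaw d
          else 0) := by
        intro u
        rw [← integral_neuronSum_sq t (fun e : Comp d dout k => e.2)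
          (F := fun e v => fderiv ℝ (fun v : (Fin d → ℝ) × ℝ => feature σ x e.1 v.1 v.2) v u)
          (fun e => continuous_fderiv_feature hσ _ _ _)
          (fun e => polyGrowth_fderiv_feature hσ hb _ _ _)]
        exact integral_nonneg fun _ => sq_nonneg _
      have hsplit : ∑ e, ∑ f, t e * t f * A e f =
          ∑ e : Comp d dout k, ∑ f : Comp d dout k, t e * t f * (if e.2 = f.2 then
            ∫ v, fderiv ℝ (fun v : (Fin d → ℝ) × ℝ => feature σ x e.1 v.1 v.2) v (0, 1) *
              fderiv ℝ (fun v : (Fin d → ℝ) × ℝ => feature σ x f.1 v.1 v.2) v (0, 1) ∂neuronLaw d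
            else 0) +
          ∑ p, ∑ e : Comp d dout k, ∑ f : Comp d dout k, t e * t f * (if e.2 = f.2 then
            ∫ v, fderiv ℝ (fun v : (Fin d → ℝ) × ℝ => feature σ x e.1 v.1 v.2) v (Pi.single p 1, 0) *
              fderiv ℝ (fun v : (Fin d → ℝ) × ℝ => feature σ x f.1 v.1 v.2) v (Pi.single p 1, 0)
                ∂neuronLaw d
            else 0) := by
        rw [Finset.sum_comm (s := (Finset.univ : Finset (Fin d))), ← Finset.sum_add_distrib]
        refine Finset.sum_congr rfl fun e _ => ?_
        rw [Finset.sum_comm (s := (Finset.univ : Finset (Fin d))), ← Finset.sum_add_distrib]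
        refine Finset.sum_congr rfl fun f _ => ?_
        rw [← Finset.mul_sum, ← mul_add]
        congr 1
        simp only [hA, Matrix.of_apply, deriv_feature_eq hσ, partialDeriv_feature_eq hσ]
        split_ifs <;> simp
      rw [hsplit]
      exact add_nonneg (key _) (Finset.sum_nonneg fun p _ => key _)
  exact (posDef_phiCov hσ hb hne x).add_posSemidef hAps

end Nondegenerate

/-! ### The limiting kernel is random -/

section Random

open scoped MatrixOrder

/-- A function whose gradient has constant length for a positive definite quadratic form is
affine. -/
theorem affine_of_quadForm_gradient_eq {ι : Type} [Fintype ι] [DecidableEq ι] {R : (ι → ℝ) → ℝ}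
    (hR : Differentiable ℝ R) {K : Matrix ι ι ℝ} (hK : K.PosDef) {c : ℝ}
    (hc : ∀ z, ∑ i, ∑ j, partialDeriv i R z * partialDeriv j R z * K i j = c) :
    ∃ (L : (ι → ℝ) →ₗ[ℝ] ℝ) (a : ℝ), ∀ z, R z = L z + a := by
  -- With `f z = R (B z)`, the gradient of `f` is `B ∇R`, whose squared norm is `∇Rᵀ K ∇R = c`.
  set B := CFC.sqrt K with hB
  have hBB : B * B = K := CFC.sqrt_mul_sqrt_self K hK.posSemidef.nonneg
  have hBsymm : Bᵀ = B := (CFC.sqrt_nonneg K).isSelfAdjoint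
  have hBunit : IsUnit B.det := by
    have := (Matrix.isUnit_iff_isUnit_det _).1 hK.isUnit
    rw [← hBB, Matrix.det_mul] at this
    exact isUnit_of_mul_isUnit_left this
  set T : EuclideanSpace ℝ ι →L[ℝ] (ι → ℝ) :=
    (LinearMap.toContinuousLinearMap B.mulVecLin).comp
      (EuclideanSpace.equiv ι ℝ : EuclideanSpace ℝ ι →L[ℝ] (ι → ℝ)) with hT
  have hTapp : ∀ z, T z = B *ᵥ WithLp.ofLp z := fun z => rfl
  set f : EuclideanSpace ℝ ι → ℝ := fun z => R (T z) with hf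
  have hderiv : ∀ z, HasFDerivAt f ((fderiv ℝ R (T z)).comp T) z := fun z =>
    (hR (T z)).hasFDerivAt.comp z T.hasFDerivAt
  have hnorm : ∀ z, ‖fderiv ℝ f z‖ = √c := by
    intro z
    set g : ι → ℝ := fun i => partialDeriv i R (T z) with hg
    have hrep : fderiv ℝ f z = InnerProductSpace.toDual ℝ (EuclideanSpace ℝ ι)
        (WithLp.toLp 2 (B *ᵥ g)) := by
      refine ContinuousLinearMap.ext fun v => ?_
      rw [(hderiv z).fderiv, InnerProductSpace.toDual_apply_apply]
      have h1 : fderiv ℝ R (T z) (T v) = T v ⬝ᵥ g := by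
        rw [← ContinuousLinearMap.coe_coe, LinearMap.pi_apply_eq_sum_univ, dotProduct]
        refine Finset.sum_congr rfl fun i _ => ?_
        have hs : (fun j => if i = j then (1 : ℝ) else 0) = Pi.single i 1 := by
          funext j
          simp only [Pi.single_apply, eq_comm]
        rw [smul_eq_mul, hs]
        rfl
      rw [ContinuousLinearMap.comp_apply, h1, hTapp, dotProduct_comm, Matrix.dotProduct_mulVec,
        ← Matrix.mulVec_transpose, hBsymm]
      simp [PiLp.inner_apply, dotProduct, mul_comm]
    rw [hrep, LinearIsometryEquiv.norm_map, EuclideanSpace.norm_eq]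
    congr 1
    rw [← hc (T z), ← dotProduct_mulVec_eq_sum K g, ← hBB, ← Matrix.mulVec_mulVec,
      Matrix.dotProduct_mulVec, ← Matrix.mulVec_transpose, hBsymm]
    simp [dotProduct, pow_two]
  have haff := affine_of_norm_fderiv_eq (fun z => (hderiv z).differentiableAt) hnorm
  refine ⟨(fderiv ℝ f 0).toLinearMap ∘ₗ
    (EuclideanSpace.equiv ι ℝ).symm.toLinearMap ∘ₗ (B⁻¹).mulVecLin, f 0, fun z => ?_⟩
  have h1 := haff (WithLp.toLp 2 (B⁻¹ *ᵥ z))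
  have h2 : T (WithLp.toLp 2 (B⁻¹ *ᵥ z)) = z := by
    rw [hTapp, Matrix.mulVec_mulVec, Matrix.mul_nonsing_inv _ hBunit, Matrix.one_mulVec]
  rw [hf] at h1
  simp only [h2] at h1
  exact h1

/-- A continuous function of a nondegenerate marginal of a Gaussian vector which is almost surely
constant is constant. -/
theorem eq_const_of_ae_multivariateGaussian {ι κ : Type} [Fintype ι] [DecidableEq ι] [Fintype κ]
    [DecidableEq κ] {S : Matrix ι ι ℝ} (hS : S.PosSemidef) (r : κ → ι)
    (hr : (S.submatrix r r).PosDef) {h : (κ → ℝ) → ℝ} (hh : Continuous h) {c : ℝ}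
    (hae : ∀ᵐ G ∂multivariateGaussian 0 S, h (fun a => G (r a)) = c) (z : κ → ℝ) : h z = c := by
  set B := CFC.sqrt S with hB
  have hBB : B * B = S := CFC.sqrt_mul_sqrt_self S hS.nonneg
  have hBsymm : Bᵀ = B := (CFC.sqrt_nonneg S).isSelfAdjoint
  -- The Gaussian vector is `B y` with `y` standard, so the marginal in question is `M y`.
  set M := B.submatrix r id with hM
  have hMM : M * Mᵀ = S.submatrix r r := by
    rw [hM, Matrix.transpose_submatrix, hBsymm, ← hBB]
    exact (Matrix.submatrix_mul _ _ r id r Function.bijective_id).symm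
  have hcontM : Continuous fun y : ι → ℝ => h (M *ᵥ y) := by fun_prop
  have hae' : ∀ᵐ y ∂(Measure.pi fun _ : ι => gaussianReal 0 1), h (M *ᵥ y) = c := by
    rw [multivariateGaussian, ← map_pi_eq_stdGaussian] at hae
    have h1 := ae_of_ae_map (Measurable.aemeasurable (by fun_prop)) hae
    have h2 := ae_of_ae_map (Measurable.aemeasurable (by fun_prop)) h1
    filter_upwards [h2] with y hy
    rw [← hy]
    congr 1
    funext a
    simp [hM, mulVec, dotProduct, hB]
  have hall := (Continuous.ae_eq_iff_eq _ hcontM continuous_const).1 hae'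
  have hunit := (Matrix.isUnit_iff_isUnit_det _).1 hr.isUnit
  -- Since `M Mᵀ` is invertible, this vector is a preimage of `z` under `M`.
  have := congrFun hall (Mᵀ *ᵥ ((S.submatrix r r)⁻¹ *ᵥ z))
  simpa only [Matrix.mulVec_mulVec, ← Matrix.mul_assoc, hMM, Matrix.mul_nonsing_inv _ hunit,
    Matrix.one_mulVec] using this

variable {din dout k Nb Nr : ℕ}

lemma limitNtk_residual (σ : ℝ → ℝ) (R : (Comp din dout k → ℝ) → ℝ) (xb : Fin Nb → Fin din → ℝ)
    (xr : Fin Nr → Fin din → ℝ) (G : Fin Nr × Comp din dout k → ℝ) (i : Fin Nr) :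
    limitNtk σ R xb xr G (Sum.inr i) (Sum.inr i) =
      ∑ e, ∑ f, partialDeriv e R (fun e => G (i, e)) * partialDeriv f R (fun e => G (i, e)) *
        phiKernel σ (xr i) (xr i) e f := by
  have hl : ∀ r, lambdaR R Nb G (Sum.inr i) (Sum.inl r) = 0 := fun _ => rfl
  have hr : ∀ a : LinRow din dout k Nb Nr → ℝ, ∑ r, lambdaR R Nb G (Sum.inr i) r * a r =
      ∑ e, partialDeriv e R (fun e => G (i, e)) * a (Sum.inr (i, e)) := by
    intro a
    have hr' : ∀ j e, lambdaR R Nb G (Sum.inr i) (Sum.inr (j, e)) =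
        if i = j then partialDeriv e R (fun e => G (i, e)) else 0 := fun _ _ => rfl
    simp only [Fintype.sum_sum_type, hl, zero_mul, Finset.sum_const_zero, zero_add]
    rw [Fintype.sum_prod_type, Finset.sum_eq_single i]
    · exact Finset.sum_congr rfl fun e _ => by rw [hr', if_pos rfl]
    · intro j _ hj
      exact Finset.sum_eq_zero fun e _ => by rw [hr', if_neg hj.symm, zero_mul]
    · exact fun h => absurd (Finset.mem_univ i) h
  rw [limitNtk_eq_sum]
  simp only [hr, mul_comm _ (lambdaR R Nb G (Sum.inr i) _)]
  simp only [Finset.mul_sum]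
  rw [Finset.sum_comm]
  refine Finset.sum_congr rfl fun e _ => Finset.sum_congr rfl fun f _ => ?_
  have : limitLinNtk (dout := dout) (k := k) σ xb xr (Sum.inr (i, e)) (Sum.inr (i, f)) =
    phiKernel σ (xr i) (xr i) e f := rfl
  rw [this]
  ring

theorem limitNtk_not_ae_const {σ : ℝ → ℝ} (hσ : ContDiff ℝ ∞ σ) (hb : BoundedDerivs k σ)
    (hne : ∃ s, iteratedDeriv k σ s ≠ 0) (xb : Fin Nb → Fin din → ℝ) (xr : Fin Nr → Fin din → ℝ)
    (hNr : 0 < Nr) {R : (Comp din dout k → ℝ) → ℝ} (hR : ContDiff ℝ 1 R)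
    (hR_nonlin : ¬ ∃ (L : (Comp din dout k → ℝ) →ₗ[ℝ] ℝ) (a : ℝ), ∀ z, R z = L z + a) :
    ¬ ∃ K₀ : Matrix (Row dout Nb Nr) (Row dout Nb Nr) ℝ,
      ∀ᵐ G ∂(limitPhiLaw σ xr dout k), limitNtk σ R xb xr (WithLp.ofLp G) = K₀ := by
  rintro ⟨K₀, hK₀⟩
  apply hR_nonlin
  let i : Fin Nr := ⟨0, hNr⟩
  have hcont : Continuous fun z : Comp din dout k → ℝ => ∑ e, ∑ f, partialDeriv e R z *
      partialDeriv f R z * phiKernel σ (xr i) (xr i) e f := by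
    have := continuous_partialDeriv hR
    fun_prop
  refine affine_of_quadForm_gradient_eq (hR.differentiable (by simp))
    (posDef_phiKernel hσ hb hne (xr i)) (c := K₀ (Sum.inr i) (Sum.inr i)) ?_
  refine eq_const_of_ae_multivariateGaussian
    (posSemidef_phiCov hσ hb (fun ie : Fin Nr × Comp din dout k => xr ie.1) (fun ie => ie.2))
    (fun e : Comp din dout k => (i, e)) (posDef_phiCov hσ hb hne (xr i)) hcont ?_
  filter_upwards [hK₀] with G hG
  rw [← hG, limitNtk_residual]

end Random

end

end PINN

theorem mainTheorem1 {din dout k Nb Nr : ℕ} (hNr : 0 < Nr)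
    (xb : Fin Nb → Fin din → ℝ) (xr : Fin Nr → Fin din → ℝ)
    (σ : ℝ → ℝ) (hσ : ContDiff ℝ ∞ σ)
    (hσ_bdd : ∃ C : ℝ, ∀ i : ℕ, 1 ≤ i → i ≤ k + 1 → ∀ s : ℝ, |iteratedDeriv i σ s| ≤ C)
    (hσ_ne : ∃ s : ℝ, iteratedDeriv k σ s ≠ 0)
    (R : (PINN.Comp din dout k → ℝ) → ℝ) (hR : ContDiff ℝ 1 R)
    (hR_nonlin : ¬ ∃ (L : (PINN.Comp din dout k → ℝ) →ₗ[ℝ] ℝ) (a : ℝ), ∀ z, R z = L z + a)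
    {Ω : Type*} [MeasurableSpace Ω] (P : Measure Ω) [IsProbabilityMeasure P]
    (θ : ∀ m : ℕ, Ω → PINN.Param din dout m)
    (hθ : ∀ m, HasLaw (θ m) (PINN.gaussianInit din dout m) P) :
    -- the factorisation of the tangent kernel
    (∀ m (θ₀ : PINN.Param din dout m), PINN.ntk σ R xb xr θ₀ =
      PINN.lambdaR R Nb (PINN.phiVec σ xr k θ₀) * PINN.linNtk (k := k) σ xb xr θ₀ *
        (PINN.lambdaR R Nb (PINN.phiVec σ xr k θ₀))ᵀ) ∧
    -- the linear part converges in probability to a deterministic matrix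
    TendstoInMeasure P
      (fun m w (p q : PINN.LinRow din dout k Nb Nr) => PINN.linNtk σ xb xr (θ m w) p q) atTop
      (fun _ p q => PINN.limitLinNtk σ xb xr p q) ∧
    -- the derivatives of the network converge in distribution to the Gaussian process
    TendstoInDistribution (fun m w => PINN.phiVec σ xr k (θ m w)) atTop
      (fun G => WithLp.ofLp G) (fun _ => P) (PINN.limitPhiLaw σ xr dout k) ∧
    -- the nonlinear factor converges in distribution to its value on the Gaussian process
    TendstoInDistribution
      (fun m w (p : PINN.Row dout Nb Nr) (q : PINN.LinRow din dout k Nb Nr) =>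
        PINN.lambdaR R Nb (PINN.phiVec σ xr k (θ m w)) p q) atTop
      (fun G p q => PINN.lambdaR R Nb (WithLp.ofLp G) p q)
      (fun _ => P) (PINN.limitPhiLaw σ xr dout k) ∧
    -- the tangent kernel at initialisation converges in distribution
    TendstoInDistribution
      (fun m w (p q : PINN.Row dout Nb Nr) => PINN.ntk σ R xb xr (θ m w) p q) atTop
      (fun G p q => PINN.limitNtk σ R xb xr (WithLp.ofLp G) p q)
      (fun _ => P) (PINN.limitPhiLaw σ xr dout k) ∧
    -- the limit is not deterministic
    ¬ ∃ K₀ : Matrix (PINN.Row dout Nb Nr) (PINN.Row dout Nb Nr) ℝ,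
      ∀ᵐ G ∂(PINN.limitPhiLaw σ xr dout k),
        PINN.limitNtk σ R xb xr (WithLp.ofLp G) = K₀ := by
  exact ⟨fun _ θ₀ => PINN.ntk_eq_mul_linNtk_mul hσ (hR.differentiable (by simp)) xb xr θ₀,
    PINN.tendstoInMeasure_linNtk hσ hσ_bdd xb xr P θ hθ,
    PINN.tendstoInDistribution_phiVec hσ hσ_bdd xr P θ hθ,
    PINN.tendstoInDistribution_lambdaR xr P θ hσ hσ_bdd hR hθ,
    PINN.tendstoInDistribution_ntk xb xr P θ hσ hσ_bdd hR hθ,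
    PINN.limitNtk_not_ae_const hσ hσ_bdd hσ_ne xb xr hNr hR hR_nonlin⟩
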